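/- Let $\alpha$ be an algebraic number with primitive minimal polynomial $A(X)=a_nX^n+\cdots+a_1X+a_0\in\mathbb{Z}[X]$, all of whose complex roots have absolute value $>1$. Let $K=\mathbb{Q}(\alpha)$, let $\mathcal{O}$ be its ring of integers, and write $\alpha\mathcal{O}=\mathfrak{a}/\mathfrak{b}$ with coprime ideals $\mathfrak{a},\mathfrak{b}$ of $\mathcal{O}$. Let $$\mathbb{K}_\alpha=\prod_{\mathfrak{p}\mid\infty\text{ or }\mathfrak{p}\mid\mathfrak{b}}K_\mathfrak{p},$$ with diagonal embedding $\Phi_\alpha:K\to\mathbb{K}_\alpha$, the multiplicative action $\xi\cdot\mathbf{z}=\Phi_\alpha(\xi)\,\mathbf{z}$ of $K$, and the product measure $\mu_\alpha$ of Lebesgue measure at the infinite primes and of the Haar measures with $\mu_\mathfrak{p}(\mathcal{O}_\mathfrak{p})=1$ at the primes $\mathfrak{p}\mid\mathfrak{b}$. A collection of compact subsets of $\mathbb{K}_\alpha$ is a tiling if $\mu_\alpha$-almost every point lies in exactly one of its members. Let $\mathcal{D}\subset\mathbb{Z}[\alpha]$ be a complete set of coset representatives of $\mathbb{Z}[\alpha]/\alpha\mathbb{Z}[\alpha]$,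 let $\mathfrak{z}=\mathbb{Z}\langle\alpha,\mathcal{D}\rangle$ be the smallest $\alpha$-invariant $\mathbb{Z}$-module containing $\mathcal{D}-\mathcal{D}$, and let $\mathcal{F}\subset\mathbb{K}_\alpha$ be the non-empty compact set with $\alpha\cdot\mathcal{F}=\bigcup_{d\in\mathcal{D}}(\mathcal{F}+\Phi_\alpha(d))$. Let $D\subset\mathbb{K}_\alpha$ be a compact set such that $\{D+\Phi_\alpha(x):x\in\mathfrak{z}\}$ is a tiling. Put $\mathcal{V}_0=\{x\in\mathfrak{z}\setminus\{0\}: D\cap(D+\Phi_\alpha(x))\neq\emptyset\}$, $\mathcal{V}_k=\{x\in\mathfrak{z}\setminus\{0\}:(\alpha x+\mathcal{D})\cap(y+\mathcal{D})\neq\emptyset\text{ for some }y\in\mathcal{V}_{k-1}\}$ for $k\ge1$, and $\mathcal{V}=\bigcup_{k\ge0}\mathcal{V}_k$. Then $\mathcal{V}$ is finite. The contact matrix is $\mathbf{C}=(c_{xy})_{x,y\in\mathcal{V}}$ with $c_{xy}=\#\big((\alpha x+\mathcal{D})\cap(y+\mathcal{D})\big)$. Let $\chi_\alpha(\mathbf{z})=\prod_\mathfrak{p}\chi_\mathfrak{p}(z_\mathfrak{p})$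 on $\mathbb{K}_\alpha$, where $\chi_\mathfrak{p}(z)=\exp(-2\pi i\,\mathrm{Tr}_{K_\mathfrak{p}:\mathbb{R}}(z))$ for $\mathfrak{p}\mid\infty$ and $\chi_\mathfrak{p}(z)=\exp(2\pi i\,\lambda_p(\mathrm{Tr}_{K_\mathfrak{p}:\mathbb{Q}_p}(z)))$ for $\mathfrak{p}\mid\mathfrak{b}$, $\mathfrak{p}\mid p$, with $\lambda_p$ the $p$-adic fractional part; let $\chi_{\alpha,x}(\mathbf{z})=\chi_\alpha(x\cdot\mathbf{z})$. Let $\widehat\Omega$ be the real vector space of functions $f=\sum_{x\in\mathcal{V}}t_x\chi_{\alpha,x}:\mathbb{K}_\alpha\to\mathbb{C}$ with $t_x\in\mathbb{R}$. The $\chi_{\alpha,x}$ are linearly independent, so $F:\widehat\Omega\to\mathbb{R}^{\mathcal{V}}$, $\sum_x t_x\chi_{\alpha,x}\mapsto(t_x)_x$, is a linear isomorphism; let $\widehat{\mathbf{C}}=F^{-1}\mathbf{C}F$. Proposition. If the collection $\{\mathcal{F}+\Phi_\alpha(x):x\in\mathfrak{z}\}$ is not a tiling of $\mathbb{K}_\alpha$,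 then there is a non-constant real-valued function $f\in\widehat\Omega$ with $\widehat{\mathbf{C}}f=|a_0|\,f$. -/

import Mathlib

open scoped NumberField
open NumberField IsDedekindDomain

namespace SelfAffine

section FinitePlaces

variable {K : Type*} [Field K] [NumberField K]

/-- The rational prime `p` below a finite prime `𝔭`, i.e. `(p) = 𝔭 ∩ ℤ`. -/
noncomputable def primeBelow (v : HeightOneSpectrum (𝓞 K)) : ℕ :=
  Ideal.absNorm (Ideal.under ℤ v.asIdeal)

instance fact_primeBelow (v : HeightOneSpectrum (𝓞 K)) : Fact (primeBelow v).Prime :=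
  haveI : NeZero v.asIdeal := ⟨v.ne_bot⟩
  haveI := v.isPrime
  ⟨Nat.absNorm_under_prime v.asIdeal⟩

theorem norm_lt_one_iff (v : HeightOneSpectrum (𝓞 K)) (x : v.adicCompletion K) :
    ‖x‖ < 1 ↔ Valued.v x < 1 := by
  rw [FinitePlace.norm_def, ← (WithZeroMulInt.toNNReal_strictMono
    (HeightOneSpectrum.one_lt_absNorm_nnreal v)).lt_iff_lt, map_one]
  exact_mod_cast Iff.rfl

theorem norm_le_one_iff (v : HeightOneSpectrum (𝓞 K)) (x : v.adicCompletion K) :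
    ‖x‖ ≤ 1 ↔ Valued.v x ≤ 1 := by
  rw [FinitePlace.norm_def, ← (WithZeroMulInt.toNNReal_strictMono
    (HeightOneSpectrum.one_lt_absNorm_nnreal v)).le_iff_le, map_one]
  exact_mod_cast Iff.rfl

theorem valued_intCast_lt_one_iff (v : HeightOneSpectrum (𝓞 K)) (m : ℤ) :
    Valued.v (algebraMap ℚ (v.adicCompletion K) m) < 1 ↔ (primeBelow v : ℤ) ∣ m := by
  have h : algebraMap ℚ (v.adicCompletion K) m = (((m : 𝓞 K) : K) : v.adicCompletion K) := by
    change _ = algebraMap K (v.adicCompletion K) ((m : 𝓞 K) : K)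
    simp
  rw [h, HeightOneSpectrum.valuedAdicCompletion_eq_valuation', 
    HeightOneSpectrum.valuation_lt_one_iff_mem, Int.cast_mem_ideal_iff]
  rfl

theorem valued_intCast_le_one (v : HeightOneSpectrum (𝓞 K)) (m : ℤ) :
    Valued.v (algebraMap ℚ (v.adicCompletion K) m) ≤ 1 := by
  have h : algebraMap ℚ (v.adicCompletion K) m = (((m : 𝓞 K) : K) : v.adicCompletion K) := by
    change _ = algebraMap K (v.adicCompletion K) ((m : 𝓞 K) : K)
    simp
  rw [h, HeightOneSpectrum.valuedAdicCompletion_eq_valuation']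
  exact v.valuation_le_one _

theorem valued_ratCast_le_one (v : HeightOneSpectrum (𝓞 K)) (q : ℚ)
    (hq : ‖(q : ℚ_[primeBelow v])‖ ≤ 1) :
    Valued.v (algebraMap ℚ (v.adicCompletion K) q) ≤ 1 := by
  have hden : ¬ (primeBelow v : ℤ) ∣ (q.den : ℤ) := by
    intro hd
    have h1 : ‖((q.den : ℤ) : ℚ_[primeBelow v])‖ < 1 := Padic.norm_intCast_lt_one_iff.2 hd
    have h2 : ‖((q.num : ℤ) : ℚ_[primeBelow v])‖ < 1 := by
      have : (q.num : ℚ_[primeBelow v]) = (q : ℚ_[primeBelow v]) * ((q.den : ℤ) : ℚ_[primeBelow v]) := by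
        have := Rat.mul_den_eq_num q
        exact_mod_cast congrArg (fun r : ℚ => (r : ℚ_[primeBelow v])) this.symm
      rw [this, norm_mul]
      nlinarith [norm_nonneg ((q.den : ℤ) : ℚ_[primeBelow v]), norm_nonneg (q : ℚ_[primeBelow v])]
    have h3 := Padic.norm_intCast_lt_one_iff.1 h2
    have h4 : (primeBelow v) ∣ Nat.gcd q.num.natAbs q.den :=
      Nat.dvd_gcd (Int.natCast_dvd.1 h3) (Int.natCast_dvd_natCast.1 hd)
    rw [q.reduced] at h4
    exact (Fact.out : (primeBelow v).Prime).one_lt.ne' (Nat.dvd_one.1 h4)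
  have h1 : Valued.v (algebraMap ℚ (v.adicCompletion K) ((q.den : ℤ) : ℚ)) = 1 :=
    le_antisymm (valued_intCast_le_one v _)
      (not_lt.1 fun h => hden ((valued_intCast_lt_one_iff v _).1 h))
  have h2 : (q.num : ℚ) = q * ((q.den : ℤ) : ℚ) := by
    exact_mod_cast (Rat.mul_den_eq_num q).symm
  have h3 := valued_intCast_le_one v q.num
  rwa [h2, map_mul, map_mul, h1, mul_one] at h3

/-- `ℚ` with the topology given by its `p`-adic valuation, mapped to `K_𝔭`. -/
noncomputable def ratToCompletion (v : HeightOneSpectrum (𝓞 K)) :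
    WithVal (Rat.padicValuation (primeBelow v)) →+* v.adicCompletion K :=
  (algebraMap ℚ (v.adicCompletion K)).comp
    (WithVal.equiv (Rat.padicValuation (primeBelow v))).toRingHom

theorem uniformContinuous_ratToCompletion (v : HeightOneSpectrum (𝓞 K)) :
    UniformContinuous (ratToCompletion v) := by
  refine uniformContinuous_of_continuousAt_zero (ratToCompletion v).toAddMonoidHom ?_
  have hpp : (primeBelow v).Prime := Fact.out
  have hp : (0 : ℝ) < primeBelow v := by exact_mod_cast hpp.pos
  have hb := (Metric.nhds_basis_ball (x := (0 : ℚ_[primeBelow v]))).comap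
    ((Rat.castHom ℚ_[primeBelow v]).comp
      (WithVal.equiv (Rat.padicValuation (primeBelow v))).toRingHom)
  have hn := (Padic.isUniformInducing_cast_withVal (p := primeBelow v)).isInducing.nhds_eq_comap 0
  rw [map_zero] at hn
  rw [ContinuousAt, hn]
  change Filter.Tendsto (ratToCompletion v) _ (nhds (ratToCompletion v 0))
  rw [map_zero]
  refine (hb.tendsto_iff Metric.nhds_basis_ball).2 fun ε hε => ?_
  set P : v.adicCompletion K := algebraMap ℚ _ ((primeBelow v : ℤ) : ℚ) with hP
  have hP1 : ‖P‖ < 1 := (norm_lt_one_iff v _).2 ((valued_intCast_lt_one_iff v _).2 dvd_rfl)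
  obtain ⟨n, hn⟩ := exists_pow_lt_of_lt_one hε hP1
  refine ⟨((primeBelow v : ℝ) ^ n)⁻¹, by positivity, fun q hq => ?_⟩
  set r : ℚ := WithVal.equiv (Rat.padicValuation (primeBelow v)) q with hr
  have hq' : ‖(r : ℚ_[primeBelow v])‖ < ((primeBelow v : ℝ) ^ n)⁻¹ := by
    simpa [hr] using hq
  have hp0 : ((primeBelow v : ℤ) : ℚ) ≠ 0 := by exact_mod_cast hpp.ne_zero
  set s : ℚ := r / ((primeBelow v : ℤ) : ℚ) ^ n with hs
  have hrs : r = ((primeBelow v : ℤ) : ℚ) ^ n * s := by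
    rw [hs]; field_simp
  have hs1 : ‖(s : ℚ_[primeBelow v])‖ ≤ 1 := by
    have : ‖(r : ℚ_[primeBelow v])‖ = ((primeBelow v : ℝ) ^ n)⁻¹ * ‖(s : ℚ_[primeBelow v])‖ := by
      rw [hrs]; push_cast; rw [norm_mul, norm_pow, Padic.norm_p, inv_pow]
    rw [this] at hq'
    have h0 : (0 : ℝ) < ((primeBelow v : ℝ) ^ n)⁻¹ := by positivity
    nlinarith
  have h1 : ratToCompletion v q = P ^ n * algebraMap ℚ _ s := by
    change algebraMap ℚ (v.adicCompletion K) r = _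
    rw [hrs, map_mul, map_pow]
  have h2 : ‖algebraMap ℚ (v.adicCompletion K) s‖ ≤ 1 :=
    (norm_le_one_iff v _).2 (valued_ratCast_le_one v s hs1)
  rw [mem_ball_zero_iff, h1, norm_mul, norm_pow]
  calc ‖P‖ ^ n * ‖algebraMap ℚ (v.adicCompletion K) s‖ ≤ ‖P‖ ^ n * 1 := by gcongr
    _ < ε := by rwa [mul_one]

/-- The embedding `ℚ_p → K_𝔭` of the completion of `ℚ` at the prime below `𝔭`: the continuous
extension of `ℚ → K_𝔭`. -/
noncomputable def padicToCompletion (v : HeightOneSpectrum (𝓞 K)) :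
    ℚ_[primeBelow v] →+* v.adicCompletion K :=
  IsDenseInducing.extendRingHom
    (i := (Rat.castHom ℚ_[primeBelow v]).comp
      (WithVal.equiv (Rat.padicValuation (primeBelow v))).toRingHom)
    (f := ratToCompletion v)
    Padic.isUniformInducing_cast_withVal
    Padic.isDenseInducing_cast_withVal.dense
    (uniformContinuous_ratToCompletion v)

/-- The local trace `Tr_{K_𝔭 : ℚ_p}`. -/
noncomputable def localTrace (v : HeightOneSpectrum (𝓞 K)) (z : v.adicCompletion K) :
    ℚ_[primeBelow v] :=
  letI := (padicToCompletion v).toAlgebra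
  Algebra.trace ℚ_[primeBelow v] (v.adicCompletion K) z

theorem finite_residueField (v : HeightOneSpectrum (𝓞 K)) :
    Finite (IsLocalRing.ResidueField (v.adicCompletionIntegers K)) := by
  let φ : 𝓞 K →+* IsLocalRing.ResidueField (v.adicCompletionIntegers K) :=
    (IsLocalRing.residue (v.adicCompletionIntegers K)).comp
      (algebraMap (𝓞 K) (v.adicCompletionIntegers K))
  have hmem : ∀ y : v.adicCompletionIntegers K, Valued.v (y : v.adicCompletion K) < 1 →
      IsLocalRing.residue (v.adicCompletionIntegers K) y = 0 := by
    intro y hy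
    rw [IsLocalRing.residue_eq_zero_iff]
    exact (Valuation.mem_maximalIdeal_iff (v.adicCompletion K) Valued.v).2 hy
  have hker : ∀ a ∈ v.asIdeal, φ a = 0 := by
    intro a ha
    refine hmem _ ?_
    change Valued.v (((a : K)) : v.adicCompletion K) < 1
    rw [HeightOneSpectrum.valuedAdicCompletion_eq_valuation']
    exact (v.valuation_lt_one_iff_mem a).2 ha
  have : Finite (𝓞 K ⧸ v.asIdeal) := v.asIdeal.finiteQuotientOfFreeOfNeBot v.ne_bot
  refine Finite.of_surjective (Ideal.Quotient.lift v.asIdeal φ hker) fun y => ?_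
  obtain ⟨y, rfl⟩ := IsLocalRing.residue_surjective y
  obtain ⟨k, hk⟩ : ∃ k : K, Valued.v ((k : v.adicCompletion K) - y) < 1 := by
    obtain ⟨k, hk⟩ := (v.denseRange_algebraMap K).exists_dist_lt (y : v.adicCompletion K) one_pos
    rw [dist_comm, dist_eq_norm, norm_lt_one_iff] at hk
    exact ⟨k, hk⟩
  have hk1 : v.valuation K k ≤ 1 := by
    rw [← HeightOneSpectrum.valuedAdicCompletion_eq_valuation' v k]
    have := Valued.v.map_add ((k : v.adicCompletion K) - y) y
    rw [sub_add_cancel] at this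
    exact this.trans (max_le hk.le y.2)
  obtain ⟨a, ha⟩ := v.exists_valuation_sub_lt_of_integer hk1 1
  refine ⟨Ideal.Quotient.mk _ a, ?_⟩
  rw [Ideal.Quotient.lift_mk, ← sub_eq_zero]
  change IsLocalRing.residue _ (algebraMap (𝓞 K) (v.adicCompletionIntegers K) a) - _ = 0
  rw [← map_sub]
  refine hmem _ ?_
  have h2 : ((algebraMap (𝓞 K) (v.adicCompletionIntegers K) a - y : v.adicCompletionIntegers K) :
      v.adicCompletion K) = (((a : K) - k : K) : v.adicCompletion K) + ((k : v.adicCompletion K) - y) := by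
    change algebraMap K (v.adicCompletion K) (a : K) - y =
      algebraMap K (v.adicCompletion K) ((a : K) - k) + (algebraMap K (v.adicCompletion K) k - y)
    rw [map_sub]
    ring
  rw [h2]
  refine (Valued.v.map_add _ _).trans_lt (max_lt ?_ hk)
  rw [HeightOneSpectrum.valuedAdicCompletion_eq_valuation']
  simpa using ha

theorem isCompact_integers (v : HeightOneSpectrum (𝓞 K)) :
    IsCompact (v.adicCompletionIntegers K : Set (v.adicCompletion K)) := by
  have hfin := finite_residueField v
  have hclosed : IsClosed (v.adicCompletionIntegers K : Set (v.adicCompletion K)) :=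
    Valued.isClosed_valuationSubring _
  have h := (Valued.integer.compactSpace_iff_completeSpace_and_isDiscreteValuationRing_and_finite_residueField
    (K := v.adicCompletion K)).2 ⟨hclosed.isComplete.completeSpace_coe, 
      inferInstanceAs (IsDiscreteValuationRing (v.adicCompletionIntegers K)), hfin⟩
  exact isCompact_iff_compactSpace.2 h

/-- The ring of integers `𝒪_𝔭` of `K_𝔭`, as a compact set with nonempty interior. -/
noncomputable def integersCompacts (v : HeightOneSpectrum (𝓞 K)) :
    TopologicalSpace.PositiveCompacts (v.adicCompletion K) where
  carrier := v.adicCompletionIntegers K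
  isCompact' := isCompact_integers v
  interior_nonempty' := by
    have h : IsOpen (v.adicCompletionIntegers K : Set (v.adicCompletion K)) :=
      Valued.isOpen_valuationSubring _
    rw [h.interior_eq]
    exact ⟨0, zero_mem _⟩

noncomputable instance measurableSpaceCompletion (v : HeightOneSpectrum (𝓞 K)) :
    MeasurableSpace (v.adicCompletion K) := borel _

instance borelSpaceCompletion (v : HeightOneSpectrum (𝓞 K)) :
    BorelSpace (v.adicCompletion K) := ⟨rfl⟩

/-- The Haar measure `μ_𝔭` on `K_𝔭`, normalized by `μ_𝔭(𝒪_𝔭) = 1` (equivalently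
`μ_𝔭(a + 𝔭^k) = 𝔑(𝔭)^{-k}`). -/
noncomputable def haarCompletion (v : HeightOneSpectrum (𝓞 K)) :
    MeasureTheory.Measure (v.adicCompletion K) :=
  MeasureTheory.Measure.addHaarMeasure (integersCompacts v)

end FinitePlaces

theorem padic_shift_norm_le {p : ℕ} [Fact p.Prime] (x : ℚ_[p]) :
    ‖(p : ℚ_[p]) ^ (-x.valuation).toNat * x‖ ≤ 1 := by
  rcases eq_or_ne x 0 with rfl | hx
  · simp
  have hp : (p : ℚ_[p]) ≠ 0 := by exact_mod_cast (Fact.out : p.Prime).ne_zero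
  rw [Padic.norm_le_one_iff_val_nonneg, Padic.valuation_mul (pow_ne_zero _ hp) hx,
    Padic.valuation_pow, Padic.valuation_p]
  have := Int.self_le_toNat (-x.valuation)
  linarith

/-- The fractional part `λ_p(x) = ∑_{j=-k}^{-1} b_j p^j` of `x = ∑_{j ≥ -k} b_j p^j ∈ ℚ_p`: with `k` such that
`p^k x ∈ ℤ_p`, it is `m / p^k`, where `0 ≤ m < p^k` and `m ≡ p^k x` modulo `p^k ℤ_p`. -/
noncomputable def padicFract {p : ℕ} [Fact p.Prime] (x : ℚ_[p]) : ℚ :=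
  (PadicInt.appr ⟨(p : ℚ_[p]) ^ (-x.valuation).toNat * x, padic_shift_norm_le x⟩
    (-x.valuation).toNat : ℚ) / (p : ℚ) ^ (-x.valuation).toNat

theorem padicFract_zero {p : ℕ} [Fact p.Prime] : padicFract (0 : ℚ_[p]) = 0 := by
  simp [padicFract, PadicInt.appr]

open MeasureTheory NumberField.mixedEmbedding

section RepresentationSpace

variable {K : Type*} [Field K] [NumberField K]

/-- The finite primes `𝔭 ∣ 𝔟`, where `α 𝒪 = 𝔞 / 𝔟` with coprime ideals `𝔞, 𝔟`: these are the
primes that occur with a negative exponent in the factorization of `α 𝒪`, i.e. at which the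
(multiplicative) `𝔭`-adic valuation of `α` exceeds `1`. -/
abbrev DenomPrime (α : K) : Type _ := {v : HeightOneSpectrum (𝓞 K) // 1 < v.valuation K α}

noncomputable instance fintypeDenomPrime (α : K) : Fintype (DenomPrime α) :=
  (HeightOneSpectrum.Support.finite (𝓞 K) α).fintype

/-- The representation space `𝕂_α = 𝕂_∞ × 𝕂_𝔟`. Here `𝕂_∞ = ℝ^r × ℂ^s` is Mathlib's
`mixedSpace K`, the product of the completions of `K` at the infinite primes. -/
abbrev RepSpace (α : K) : Type _ :=
  mixedSpace K × ((v : DenomPrime α) → v.1.adicCompletion K)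

/-- The diagonal ring homomorphism `Φ_α : K → 𝕂_α`. -/
noncomputable def diag (α : K) : K →+* RepSpace α :=
  (mixedEmbedding K).prod (RingHom.pi fun v => algebraMap K (v.1.adicCompletion K))

open scoped Classical in
/-- The measure `μ_α` on `𝕂_α`: the product of Lebesgue measure on `𝕂_∞` and of the normalized
Haar measures `μ_𝔭`, `𝔭 ∣ 𝔟`. -/
noncomputable def repMeasure (α : K) : Measure (RepSpace α) :=
  (volume : Measure (mixedSpace K)).prod (Measure.pi fun v : DenomPrime α => haarCompletion v.1)

end RepresentationSpace

section Tilings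

/-- A collection `C` of compact subsets of `X` is a multiple tiling of multiplicity `m ≥ 1` if
almost every point of `X` is contained in exactly `m` elements of `C`. -/
def IsMultipleTiling {X : Type*} [TopologicalSpace X] [MeasurableSpace X] (μ : Measure X)
    (C : Set (Set X)) (m : ℕ) : Prop :=
  0 < m ∧ (∀ S ∈ C, IsCompact S) ∧ ∀ᵐ z ∂μ, {S | S ∈ C ∧ z ∈ S}.encard = m

/-- A tiling is a multiple tiling of multiplicity `1`. -/
def IsTiling {X : Type*} [TopologicalSpace X] [MeasurableSpace X] (μ : Measure X)
    (C : Set (Set X)) : Prop :=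
  IsMultipleTiling μ C 1

end Tilings

section Tiles

variable {K : Type*} [Field K] [NumberField K]

/-- `A` is the primitive minimal polynomial of `α` in `ℤ[X]` (it is unique up to sign). -/
def IsPrimitiveMinpoly (A : Polynomial ℤ) (α : K) : Prop :=
  A.IsPrimitive ∧ Irreducible A ∧ Polynomial.aeval α A = 0

/-- All complex roots of `A` lie outside the closed unit disc. -/
def IsExpanding (A : Polynomial ℤ) : Prop :=
  ∀ z : ℂ, Polynomial.aeval z A = 0 → 1 < ‖z‖

/-- `𝒟` is a standard digit set for `α`: a complete set of coset representatives of
`ℤ[α] / α ℤ[α]`. -/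
def IsStandardDigitSet (α : K) (𝒟 : Set K) : Prop :=
  (∀ d ∈ 𝒟, d ∈ Algebra.adjoin ℤ {α}) ∧
    ∀ x ∈ Algebra.adjoin ℤ {α}, ∃! d, d ∈ 𝒟 ∧ ∃ y ∈ Algebra.adjoin ℤ {α}, x - d = α * y

/-- `ℤ⟨α, 𝒟⟩`: the smallest `α`-invariant `ℤ`-submodule containing `𝒟 - 𝒟`. -/
def digitModule (α : K) (𝒟 : Set K) : Submodule ℤ K :=
  sInf {M | (∀ d ∈ 𝒟, ∀ d' ∈ 𝒟, d - d' ∈ M) ∧ ∀ x ∈ M, α * x ∈ M}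

/-- The translate `F + Φ_α(x)`. -/
def translate (α : K) (F : Set (RepSpace α)) (x : K) : Set (RepSpace α) :=
  (fun z => z + diag α x) '' F

/-- The collection `{F + Φ_α(x) : x ∈ ℤ⟨α, 𝒟⟩}`. -/
def translates (α : K) (𝒟 : Set K) (F : Set (RepSpace α)) : Set (Set (RepSpace α)) :=
  translate α F '' (digitModule α 𝒟 : Set K)

/-- `F = 𝓕(α, 𝒟)`: the nonempty compact set with `α · F = ⋃_{d ∈ 𝒟} (F + Φ_α(d))`. -/
def IsSelfAffineTile (α : K) (𝒟 : Set K) (F : Set (RepSpace α)) : Prop :=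
  F.Nonempty ∧ IsCompact F ∧ (fun z => diag α α * z) '' F = ⋃ d ∈ 𝒟, translate α F d

end Tiles

section Contact

variable {K : Type*} [Field K] [NumberField K]

/-- The sets `𝒱_k`, starting from the neighbours of the compact set `D`. -/
def contactStep (α : K) (𝒟 : Set K) (D : Set (RepSpace α)) : ℕ → Set K
  | 0 => {x | x ∈ digitModule α 𝒟 ∧ x ≠ 0 ∧ (D ∩ translate α D x).Nonempty}
  | k + 1 => {x | x ∈ digitModule α 𝒟 ∧ x ≠ 0 ∧ ∃ y ∈ contactStep α 𝒟 D k,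
      (((fun d => α * x + d) '' 𝒟) ∩ ((fun d => y + d) '' 𝒟)).Nonempty}

/-- The index set `𝒱 = ⋃_k 𝒱_k` of the contact matrix. -/
def contactSet (α : K) (𝒟 : Set K) (D : Set (RepSpace α)) : Set K :=
  ⋃ k, contactStep α 𝒟 D k

/-- The contact matrix `c_{xy} = #((α x + 𝒟) ∩ (y + 𝒟))`, `x, y ∈ V`. -/
noncomputable def contactMatrix (α : K) (𝒟 V : Set K) : Matrix V V ℝ :=
  Matrix.of fun x y => ((((fun d => α * (x : K) + d) '' 𝒟) ∩ ((fun d => (y : K) + d) '' 𝒟)).ncard : ℝ)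

end Contact

section Fourier

variable {K : Type*} [Field K] [NumberField K]

open scoped Classical in
/-- The product over the infinite primes of the characters
`χ_𝔭(z) = exp(-2πi Tr_{K_𝔭 : ℝ}(z))`. -/
noncomputable def charInfinite (z : mixedSpace K) : ℂ :=
  (∏ w, Complex.exp (-2 * Real.pi * Complex.I * (z.1 w : ℂ))) *
    ∏ w, Complex.exp (-2 * Real.pi * Complex.I * (Algebra.trace ℝ ℂ (z.2 w) : ℂ))

/-- The character `χ_𝔭(z) = exp(2πi λ_p(Tr_{K_𝔭 : ℚ_p}(z)))` for a finite prime `𝔭`. -/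
noncomputable def charFinite (v : HeightOneSpectrum (𝓞 K)) (z : v.adicCompletion K) : ℂ :=
  Complex.exp (2 * Real.pi * Complex.I * (padicFract (localTrace v z) : ℂ))

/-- The character `χ_α` of `𝕂_α`. -/
noncomputable def charRep (α : K) (z : RepSpace α) : ℂ :=
  charInfinite z.1 * ∏ v, charFinite v.1 (z.2 v)

/-- The character `χ_{α,ξ}(z) = χ_α(ξ · z)`. -/
noncomputable def charTwist (α ξ : K) (z : RepSpace α) : ℂ :=
  charRep α (diag α ξ * z)

/-- `F⁻¹ : Ω = ℝ^V → (𝕂_α → ℂ)`, `(t_x) ↦ ∑_{x ∈ V} t_x χ_{α,x}`. -/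
noncomputable def fourierInv (α : K) (V : Set K) [Fintype V] :
    (V → ℝ) →ₗ[ℝ] (RepSpace α → ℂ) where
  toFun t := fun z => ∑ x : V, (t x : ℂ) * charTwist α x z
  map_add' s t := by
    funext z; simp [add_mul, Finset.sum_add_distrib]
  map_smul' c t := by
    funext z; simp [Finset.mul_sum, mul_assoc]

theorem charInfinite_add (a b : mixedSpace K) :
    charInfinite (a + b) = charInfinite a * charInfinite b := by
  simp only [charInfinite, mul_add, Prod.fst_add, Prod.snd_add, Pi.add_apply,
    map_add, Complex.ofReal_add, Complex.exp_add, Finset.prod_mul_distrib]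
  ring

theorem charInfinite_zero : charInfinite (0 : mixedSpace K) = 1 := by
  simp [charInfinite]

theorem charInfinite_smul_one (s : ℝ) :
    charInfinite (s • (1 : mixedSpace K)) =
      Complex.exp (-2 * Real.pi * Complex.I * (s * Module.finrank ℚ K)) := by
  have h := InfinitePlace.card_add_two_mul_card_eq_rank K
  rw [← h]
  simp only [charInfinite, Prod.smul_fst, Prod.smul_snd, Pi.smul_apply, Prod.fst_one,
    Prod.snd_one, Pi.one_apply, Algebra.trace_complex_apply, Finset.prod_const, ← Complex.exp_nat_mul,
    ← Complex.exp_add, Finset.card_univ]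
  congr 1
  simp [InfinitePlace.nrRealPlaces, InfinitePlace.nrComplexPlaces]
  ring

/-- The infinite part of `χ_{α,ξ}` as a homomorphism. -/
noncomputable def charInfiniteHom (ξ : K) : Multiplicative (mixedSpace K) →* ℂ where
  toFun z := charInfinite (mixedEmbedding K ξ * z.toAdd)
  map_one' := by simp [charInfinite_zero]
  map_mul' a b := by
    simp [mul_add, charInfinite_add]

theorem charInfiniteHom_injective :
    Function.Injective (charInfiniteHom : K → Multiplicative (mixedSpace K) →* ℂ) := by
  intro ξ η h
  by_contra hne
  have hn : (Module.finrank ℚ K : ℝ) ≠ 0 := by exact_mod_cast Module.finrank_pos.ne'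
  have hsub : ξ - η ≠ 0 := sub_ne_zero.2 hne
  set s : ℝ := (2 * Module.finrank ℚ K)⁻¹ with hs
  set z : mixedSpace K := s • mixedEmbedding K (ξ - η)⁻¹ with hz
  have h1 : charInfinite (mixedEmbedding K ξ * z) = charInfinite (mixedEmbedding K η * z) :=
    DFunLike.congr_fun h (Multiplicative.ofAdd z)
  have h2 : mixedEmbedding K ξ * z = s • (1 : mixedSpace K) + mixedEmbedding K η * z := by
    have : mixedEmbedding K (ξ - η) * z = s • (1 : mixedSpace K) := by
      rw [hz, mul_smul_comm, ← map_mul, mul_inv_cancel₀ hsub, map_one]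
    rw [← this, map_sub]
    ring
  have h3 : charInfinite (mixedEmbedding K η * z) ≠ 0 := by
    intro h0
    have h4 := charInfinite_add (mixedEmbedding K η * z) (-(mixedEmbedding K η * z))
    rw [h0, add_neg_cancel, charInfinite_zero, zero_mul] at h4
    exact one_ne_zero h4
  rw [h2, charInfinite_add] at h1
  have h5 : charInfinite (s • (1 : mixedSpace K)) = 1 := by
    have := mul_right_cancel₀ h3 (h1.trans (one_mul _).symm)
    exact this
  rw [charInfinite_smul_one] at h5
  have hnC : (Module.finrank ℚ K : ℂ) ≠ 0 := by exact_mod_cast hn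
  have h6 : -2 * Real.pi * Complex.I * ((s : ℂ) * Module.finrank ℚ K) = -(Real.pi * Complex.I) := by
    rw [hs]; push_cast; field_simp
  rw [h6, Complex.exp_neg, Complex.exp_pi_mul_I] at h5
  norm_num at h5

theorem charTwist_infinite (α ξ : K) (z : mixedSpace K) :
    charTwist α ξ (z, 0) = charInfiniteHom ξ (Multiplicative.ofAdd z) := by
  simp [charTwist, charRep, charInfiniteHom, charFinite, localTrace, padicFract_zero, diag]

/-- The characters `χ_{α,x}` are linearly independent, so the coefficients `t_x` are determined by
the function `∑ t_x χ_{α,x}`. -/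
theorem fourierInv_injective (α : K) (V : Set K) [Fintype V] :
    Function.Injective (fourierInv α V) := by
  rw [← LinearMap.ker_eq_bot, LinearMap.ker_eq_bot']
  intro t ht
  have hli := (linearIndependent_monoidHom (Multiplicative (mixedSpace K)) ℂ).comp
    (fun x : V => (charInfiniteHom (x : K)))
    (charInfiniteHom_injective.comp Subtype.val_injective)
  rw [Fintype.linearIndependent_iff] at hli
  funext x
  have := hli (fun x => (t x : ℂ)) (by
    funext z
    have h := congrFun ht (z.toAdd, 0)
    simp only [fourierInv, LinearMap.coe_mk, AddHom.coe_mk, charTwist_infinite] at h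
    simpa using h) x
  exact_mod_cast this

/-- The space `Ω̂` of functions `∑_{x ∈ V} t_x χ_{α,x}` on `𝕂_α` with real coefficients `t_x`. -/
noncomputable def OmegaHat (α : K) (V : Set K) [Fintype V] : Submodule ℝ (RepSpace α → ℂ) :=
  LinearMap.range (fourierInv α V)

/-- The Fourier transform `F : Ω̂ → Ω`, `∑ t_x χ_{α,x} ↦ (t_x)`. -/
noncomputable def fourierCoeffs (α : K) (V : Set K) [Fintype V] : OmegaHat α V ≃ₗ[ℝ] (V → ℝ) :=
  (LinearEquiv.ofInjective (fourierInv α V) (fourierInv_injective α V)).symm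

/-- The Fourier transform `Ĉ = F⁻¹ C F` of the contact matrix. -/
noncomputable def contactHat (α : K) (𝒟 V : Set K) [Fintype V] : OmegaHat α V →ₗ[ℝ] OmegaHat α V :=
  (fourierCoeffs α V).symm.toLinearMap ∘ₗ (contactMatrix α 𝒟 V).mulVecLin ∘ₗ (fourierCoeffs α V).toLinearMap

end Fourier

end SelfAffine

open SelfAffine

/-! Write `q = |a₀| = #𝒟` and `I = ℤ⟨α, 𝒟⟩`. The heart of the proof is the contrapositive statement
`isTiling_of_contactMatrix`: if `q` is not an eigenvalue of the contact matrix `C`, then the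
translates of `F` by `I` tile.

Subtract a fixed digit `d₀` from all digits, and let `S_n` be the set of `n`-digit sums. Count the
elements of `S_n` that leave `S_n` under translation by `y`. Passing a carry from the lowest digit
to the rest bounds this count, for `y ∈ 𝒱`, by one step of the transpose of `C` applied to the
counts for `n - 1` (`IsDigitSystem.exitCount_succ_le`). The column sums of `C` are at most `q`, so
the iterates of the constant vector `1` under `s ↦ q⁻¹ s C` decrease to a left fixed vector. That
vector vanishes if `q` is not an eigenvalue, so for each `y ∈ 𝒱` the proportion of elements that
leave tends to `0`.

The `y ∈ I` with this property form an `α`-invariant subgroup containing the neighbours of `D`. Such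
a subgroup is all of `I` (`le_of_neighbors_mem`): otherwise its translates of `D` would form a
clopen set, which is excluded by connectedness of `𝕂_∞` and density in the finite part. Hence every
`y ∈ I` is a difference of two elements of some `S_n`. Now `αⁿF` is the union of the `F + Φ_α(e)`,
`e ∈ S_n`, and has measure `qⁿ μ(F)`, so these pieces are almost disjoint; thus `F` and `F + Φ_α(y)`
overlap in a null set for `y ≠ 0`. Covering follows from expansion by `α`.

The digits represent `ℤ[α]/αℤ[α]` by assumption, but the argument needs them to represent `I/αI`.
This comes from comparing volumes (`IsStandardDigitSet.isDigitSystem`).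

Finally, if there is no tiling, take an eigenvector of `C` for `q`. Its absolute value is again an
eigenvector, and symmetrizing under `x ↦ -x` keeps it nonzero. Even coefficients give a real
function; it is not constant, since `0 ∉ 𝒱` and distinct characters are independent. -/

namespace SelfAffine

open Filter Topology MeasureTheory NumberField.mixedEmbedding
open scoped Pointwise

/-! ### Digit sums and how many of them a translation moves out of the set. -/

section DigitSums

variable {G : Type*} [AddCommGroup G]

/-- `E ⊆ I` represents every element of `I / T I` exactly once, `T` being injective. -/
structure IsDigitSystem (T : G →+ G) (E : Finset G) (I : AddSubgroup G) : Prop where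
  injective : Function.Injective T
  map_mem : ∀ x ∈ I, T x ∈ I
  digit_mem : ∀ d ∈ E, d ∈ I
  exists_digit : ∀ x ∈ I, ∃ d ∈ E, ∃ y ∈ I, x = d + T y
  digit_unique : ∀ d ∈ E, ∀ d' ∈ E, ∀ y ∈ I, ∀ y' ∈ I, d + T y = d' + T y' → d = d'

variable {T : G →+ G} {E : Finset G} {I : AddSubgroup G}

theorem IsDigitSystem.nonempty (h : IsDigitSystem T E I) : E.Nonempty :=
  let ⟨d, hd, _⟩ := h.exists_digit 0 I.zero_mem
  ⟨d, hd⟩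

theorem IsDigitSystem.digit_unique' (h : IsDigitSystem T E I) {d d' y y' : G} (hd : d ∈ E) (hd' : d' ∈ E)
    (hy : y ∈ I) (hy' : y' ∈ I) (heq : d + T y = d' + T y') : d = d' ∧ y = y' := by
  have h1 := h.digit_unique d hd d' hd' y hy y' hy' heq
  subst h1
  exact ⟨rfl, h.injective (add_left_cancel heq)⟩

variable [DecidableEq G]

/-- The sums `d₀ + T d₁ + ⋯ + T^(n-1) d_(n-1)` with digits `dⱼ ∈ E`. -/
def digitSums (T : G →+ G) (E : Finset G) : ℕ → Finset G
  | 0 => {0}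
  | n + 1 => Finset.image₂ (fun d e => d + T e) E (digitSums T E n)

/-- The number of `n`-digit sums that leave the set of `n`-digit sums when translated by `y`. -/
def exitCount (T : G →+ G) (E : Finset G) (n : ℕ) (y : G) : ℕ :=
  ((digitSums T E n).filter fun e => e + y ∉ digitSums T E n).card

theorem digitSums_zero : digitSums T E 0 = {0} := rfl

theorem mem_digitSums_succ {n : ℕ} {x : G} :
    x ∈ digitSums T E (n + 1) ↔ ∃ d ∈ E, ∃ e ∈ digitSums T E n, d + T e = x := by
  simp [digitSums, Finset.mem_image₂]

namespace IsDigitSystem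

theorem digitSums_subset (h : IsDigitSystem T E I) (n : ℕ) : ∀ x ∈ digitSums T E n, x ∈ I := by
  induction n with
  | zero => intro x hx; rw [digitSums_zero, Finset.mem_singleton] at hx; exact hx ▸ I.zero_mem
  | succ n ih =>
    intro x hx
    obtain ⟨d, hd, e, he, rfl⟩ := mem_digitSums_succ.1 hx
    exact I.add_mem (h.digit_mem d hd) (h.map_mem e (ih e he))

theorem card_digitSums (h : IsDigitSystem T E I) (n : ℕ) :
    (digitSums T E n).card = E.card ^ n := by
  induction n with
  | zero => simp [digitSums_zero]
  | succ n ih =>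
    rw [digitSums, pow_succ', ← ih]
    refine Finset.card_image₂_iff.2 ?_
    rintro ⟨d, e⟩ ⟨hd, he⟩ ⟨d', e'⟩ ⟨hd', he'⟩ heq
    obtain ⟨h1, h2⟩ := h.digit_unique' hd hd' (h.digitSums_subset n _ he)
      (h.digitSums_subset n _ he') heq
    exact Prod.ext h1 h2

end IsDigitSystem

theorem exitCount_le_card (n : ℕ) (y : G) : exitCount T E n y ≤ (digitSums T E n).card :=
  Finset.card_filter_le _ _

theorem exitCount_self_zero (n : ℕ) : exitCount T E n 0 = 0 := by
  simp [exitCount, Finset.filter_eq_empty_iff]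

/-- An element that leaves under `y + z` either leaves under `y`, or stays under `y` and then leaves
under `z`. With negation symmetry this makes `almostStabilizer` a group. -/
theorem exitCount_add_le (n : ℕ) (y z : G) :
    exitCount T E n (y + z) ≤ exitCount T E n y + exitCount T E n z := by
  classical
  set S := digitSums T E n with hS
  have hsub : S.filter (fun e => e + (y + z) ∉ S) ⊆ S.filter (fun e => e + y ∉ S) ∪
      (S.filter (fun e => e + z ∉ S)).image (fun e => e - y) := by
    intro e he
    rw [Finset.mem_filter] at he
    by_cases hy : e + y ∈ S
    · refine Finset.mem_union_right _ (Finset.mem_image.2 ⟨e + y, ?_, by abel⟩)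
      exact Finset.mem_filter.2 ⟨hy, by rw [add_assoc]; exact he.2⟩
    · exact Finset.mem_union_left _ (Finset.mem_filter.2 ⟨he.1, hy⟩)
  exact (Finset.card_le_card hsub).trans ((Finset.card_union_le _ _).trans
    (Nat.add_le_add_left Finset.card_image_le _))

/-- Adding `y` is a bijection from the elements that stay under `y` to those that stay under `-y`.
-/
theorem exitCount_neg (n : ℕ) (y : G) : exitCount T E n (-y) = exitCount T E n y := by
  classical
  set S := digitSums T E n with hS
  have key : ∀ z, (S.filter fun e => e + z ∈ S).card + exitCount T E n z = S.card :=
    fun z => Finset.card_filter_add_card_filter_not _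
  have h : (S.filter fun e => e + y ∈ S).card = (S.filter fun e => e + -y ∈ S).card := by
    refine Finset.card_bij' (fun e _ => e + y) (fun e _ => e + -y) ?_ ?_ ?_ ?_ <;>
      simp +contextual
  have h1 := key y
  have h2 := key (-y)
  omega

/-- Adding `T y` can leave the lowest digit alone and act as `y` on the remaining sum, so leaving
forces the remaining sum to leave. -/
theorem exitCount_map_le (n : ℕ) (y : G) :
    exitCount T E (n + 1) (T y) ≤ E.card * exitCount T E n y := by
  have hsub : (digitSums T E (n + 1)).filter (fun e => e + T y ∉ digitSums T E (n + 1)) ⊆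
      Finset.image₂ (fun d e => d + T e) E
        ((digitSums T E n).filter fun e => e + y ∉ digitSums T E n) := by
    intro x hx
    obtain ⟨hx, hxy⟩ := Finset.mem_filter.1 hx
    obtain ⟨d, hd, e, he, rfl⟩ := mem_digitSums_succ.1 hx
    refine Finset.mem_image₂.2 ⟨d, hd, e, Finset.mem_filter.2 ⟨he, fun h => hxy ?_⟩, rfl⟩
    exact mem_digitSums_succ.2 ⟨d, hd, e + y, h, by rw [map_add]; abel⟩
  exact (Finset.card_le_card hsub).trans (Finset.card_image₂_le _ _ _)

/-- The elements `y ∈ I` such that almost all `n`-digit sums stay `n`-digit sums when translated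
by `y`, as `n → ∞`. -/
noncomputable def almostStabilizer (T : G →+ G) (E : Finset G) (I : AddSubgroup G) :
    AddSubgroup G where
  carrier := {y | y ∈ I ∧
    Tendsto (fun n => (exitCount T E n y : ℝ) / (E.card : ℝ) ^ n) atTop (𝓝 0)}
  zero_mem' := ⟨I.zero_mem, by simp [exitCount_self_zero]⟩
  add_mem' := by
    rintro y z ⟨hy, hy'⟩ ⟨hz, hz'⟩
    refine ⟨I.add_mem hy hz, squeeze_zero (fun n => by positivity) (fun n => ?_)
      (by simpa using hy'.add hz')⟩
    rw [← add_div]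
    gcongr
    exact_mod_cast exitCount_add_le n y z
  neg_mem' := by
    rintro y ⟨hy, hy'⟩
    exact ⟨I.neg_mem hy, by simpa only [exitCount_neg] using hy'⟩

theorem IsDigitSystem.map_mem_almostStabilizer (h : IsDigitSystem T E I) {y : G}
    (hy : y ∈ almostStabilizer T E I) : T y ∈ almostStabilizer T E I := by
  have hq : (0 : ℝ) < E.card := by exact_mod_cast h.nonempty.card_pos
  refine ⟨h.map_mem y hy.1, (tendsto_add_atTop_iff_nat 1).1 ?_⟩
  refine squeeze_zero (fun n => by positivity) (fun n => ?_) hy.2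
  rw [div_le_div_iff₀ (by positivity) (by positivity), pow_succ]
  have := exitCount_map_le (T := T) (E := E) n y
  have h' : (exitCount T E (n + 1) (T y) : ℝ) ≤ E.card * exitCount T E n y := by exact_mod_cast this
  calc (exitCount T E (n + 1) (T y) : ℝ) * (E.card : ℝ) ^ n
      ≤ (E.card * exitCount T E n y) * (E.card : ℝ) ^ n := by gcongr
    _ = _ := by ring

/-- Once the proportion of elements that leave is below `1`, some element stays. -/
theorem IsDigitSystem.exists_add_mem_digitSums (h : IsDigitSystem T E I) {y : G}
    (hy : y ∈ almostStabilizer T E I) :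
    ∃ n, ∃ e ∈ digitSums T E n, e + y ∈ digitSums T E n := by
  have hq : (0 : ℝ) < E.card := by exact_mod_cast h.nonempty.card_pos
  obtain ⟨n, hn⟩ := (hy.2.eventually (gt_mem_nhds one_pos)).exists
  refine ⟨n, ?_⟩
  by_contra! hne
  have h1 : exitCount T E n y = E.card ^ n := by
    rw [exitCount, Finset.filter_true_of_mem hne, h.card_digitSums]
  rw [h1, Nat.cast_pow, div_self (by positivity)] at hn
  exact lt_irrefl _ hn

/-- The entries `#((T x + E) ∩ (y + E))` of the contact matrix. -/
def contactCount (T : G →+ G) (E : Finset G) (x y : G) : ℕ :=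
  ((E.image fun d => T x + d) ∩ (E.image fun d => y + d)).card

/-- Carry propagation: if `y + d' = d + T x`, then `(d' + T e) + y = d + T (e + x)`, so leaving
under `y` forces `e` to leave under the carry `x`. In particular `x ≠ 0`, whence `x ∈ V`. The pairs
`(d, d')` with carry `x` correspond to the points `s = y + d'` of `(T x + E) ∩ (y + E)`. -/
theorem IsDigitSystem.exitCount_succ_le (h : IsDigitSystem T E I) {V : Set G} [Fintype V] {y : G}
    (hy : y ∈ I)
    (hV : ∀ x ∈ I, x ≠ 0 → ∀ d ∈ E, ∀ d' ∈ E, T x + d = y + d' → x ∈ V) (n : ℕ) :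
    exitCount T E (n + 1) y ≤ ∑ x : V, contactCount T E x y * exitCount T E n x := by
  set S := fun n => digitSums T E n with hS
  have hsub : (S (n + 1)).filter (fun e => e + y ∉ S (n + 1)) ⊆
      (Finset.univ : Finset V).biUnion fun x =>
        Finset.image₂ (fun s e => s - y + T e)
          ((E.image fun d => T (x : G) + d) ∩ (E.image fun d => y + d))
          ((S n).filter fun e => e + (x : G) ∉ S n) := by
    intro z hz
    obtain ⟨hz, hzy⟩ := Finset.mem_filter.1 hz
    obtain ⟨d', hd', e, he, rfl⟩ := mem_digitSums_succ.1 hz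
    obtain ⟨d, hd, x, hx, hdx⟩ := h.exists_digit (y + d') (I.add_mem hy (h.digit_mem d' hd'))
    have hex : e + x ∉ S n := fun hex =>
      hzy (mem_digitSums_succ.2 ⟨d, hd, e + x, hex, by
        rw [map_add, add_comm (T e), ← add_assoc, ← hdx]; abel⟩)
    have hx0 : x ≠ 0 := by
      rintro rfl
      exact hex (by rwa [add_zero])
    have hxV : x ∈ V := hV x hx hx0 d hd d' hd' (by rw [hdx, add_comm])
    refine Finset.mem_biUnion.2 ⟨⟨x, hxV⟩, Finset.mem_univ _, Finset.mem_image₂.2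
      ⟨y + d', Finset.mem_inter.2 ⟨?_, ?_⟩, e, Finset.mem_filter.2 ⟨he, hex⟩, by abel⟩⟩
    · exact Finset.mem_image.2 ⟨d, hd, by rw [hdx, add_comm]⟩
    · exact Finset.mem_image.2 ⟨d', hd', rfl⟩
  refine (Finset.card_le_card hsub).trans (Finset.card_biUnion_le.trans ?_)
  exact Finset.sum_le_sum fun x _ => Finset.card_image₂_le _ _ _

/-- For fixed `y` the sets counted are disjoint subsets of `y + E`. -/
theorem sum_contactCount_le {V : Set G} [Fintype V]
    (hV : ∀ d ∈ E, ∀ d' ∈ E, ∀ x ∈ V, ∀ x' ∈ V, d + T x = d' + T x' → x = x') (y : G) : ∑ x : V, contactCount T E x y ≤ E.card := by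
  rw [← Finset.card_image_of_injective E (add_right_injective y)]
  unfold contactCount
  rw [← Finset.card_biUnion]
  · exact Finset.card_le_card (Finset.biUnion_subset.2 fun x _ => Finset.inter_subset_right)
  · intro x _ x' _ hne
    refine Finset.disjoint_left.2 fun s hs hs' => hne ?_
    obtain ⟨d, hd, hds⟩ := Finset.mem_image.1 (Finset.mem_inter.1 hs).1
    obtain ⟨d', hd', hds'⟩ := Finset.mem_image.1 (Finset.mem_inter.1 hs').1
    refine Subtype.ext (hV d hd d' hd' x x.2 x' x'.2 ?_)
    rw [add_comm, hds, add_comm, hds']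

end DigitSums

/-! ### Nonnegative matrices with bounded column sums. -/

section NonnegativeMatrix

variable {V : Type*} [Fintype V] {C : Matrix V V ℝ} {q : ℝ}

/-- A square matrix has the same left and right eigenvalues, both being detected by `det (C - q)`.
-/
theorem eq_zero_of_vecMul_eq_smul [DecidableEq V] (hno : ∀ t : V → ℝ, C.mulVec t = q • t → t = 0)
    {s : V → ℝ} (hs : C.vecMul s = q • s) : s = 0 := by
  by_contra hs0
  have h1 : (C - q • (1 : Matrix V V ℝ)).det = 0 :=
    Matrix.exists_vecMul_eq_zero_iff.1 ⟨s, hs0, by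
      simp [Matrix.vecMul_sub, hs, Matrix.vecMul_smul]⟩
  obtain ⟨t, ht0, ht⟩ := Matrix.exists_mulVec_eq_zero_iff.2 h1
  rw [Matrix.sub_mulVec, Matrix.smul_mulVec, Matrix.one_mulVec, sub_eq_zero] at ht
  exact ht0 (hno t ht)

/-- The iterates of `1` under `s ↦ q⁻¹ (s C)`. -/
noncomputable def massIterate (C : Matrix V V ℝ) (q : ℝ) : ℕ → V → ℝ
  | 0 => 1
  | n + 1 => q⁻¹ • C.vecMul (massIterate C q n)

theorem vecMul_mono (hC : ∀ x y, 0 ≤ C x y) {s t : V → ℝ} (h : s ≤ t) :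
    C.vecMul s ≤ C.vecMul t := fun y =>
  Finset.sum_le_sum fun x _ => mul_le_mul_of_nonneg_right (h x) (hC x y)

theorem antitone_massIterate (hC : ∀ x y, 0 ≤ C x y) (hq : 0 < q) (hsum : ∀ y, ∑ x, C x y ≤ q) :
    Antitone (massIterate C q) := by
  refine antitone_nat_of_succ_le fun n => ?_
  induction n with
  | zero =>
    intro y
    change q⁻¹ * ∑ x, 1 * C x y ≤ 1
    rw [inv_mul_le_iff₀ hq, mul_one]
    simpa using hsum y
  | succ n ih => exact smul_le_smul_of_nonneg_left (vecMul_mono hC ih) (by positivity)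

theorem massIterate_nonneg (hC : ∀ x y, 0 ≤ C x y) (hq : 0 < q) (n : ℕ) :
    0 ≤ massIterate C q n := by
  induction n with
  | zero => exact zero_le_one
  | succ n ih =>
    intro y
    exact mul_nonneg (by positivity) (Finset.sum_nonneg fun x _ => mul_nonneg (ih x) (hC x y))

/-- The iterates decrease and are nonnegative, so they converge; their limit is a left eigenvector
for `q`, hence zero. -/
theorem tendsto_massIterate (hC : ∀ x y, 0 ≤ C x y) (hq : 0 < q) (hsum : ∀ y, ∑ x, C x y ≤ q)
    (hno : ∀ t : V → ℝ, C.mulVec t = q • t → t = 0) (y : V) :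
    Tendsto (fun n => massIterate C q n y) atTop (𝓝 0) := by
  classical
  have hlim : ∀ y, ∃ l, Tendsto (fun n => massIterate C q n y) atTop (𝓝 l) := fun y =>
    ⟨_, tendsto_atTop_ciInf (fun m n hmn => antitone_massIterate hC hq hsum hmn y)
      ⟨0, by rintro _ ⟨n, rfl⟩; exact massIterate_nonneg hC hq n y⟩⟩
  choose l hl using hlim
  have h1 : ∀ y, l y = q⁻¹ * C.vecMul l y := fun y => by
    refine tendsto_nhds_unique ((tendsto_add_atTop_iff_nat 1).2 (hl y)) ?_
    exact (tendsto_finsetSum _ fun x _ => (hl x).mul_const _).const_mul q⁻¹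
  have h2 : l = 0 := eq_zero_of_vecMul_eq_smul hno (funext fun y => by
    rw [Pi.smul_apply, smul_eq_mul, h1 y, mul_inv_cancel_left₀ hq.ne'])
  simpa [h2] using hl y

theorem tendsto_zero_of_subinvariant (hC : ∀ x y, 0 ≤ C x y) (hq : 0 < q)
    (hsum : ∀ y, ∑ x, C x y ≤ q) (hno : ∀ t : V → ℝ, C.mulVec t = q • t → t = 0)
    {b : ℕ → V → ℝ} (hb : ∀ n, 0 ≤ b n) (hb0 : b 0 ≤ 1)
    (hstep : ∀ n, b (n + 1) ≤ q⁻¹ • C.vecMul (b n)) (y : V) :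
    Tendsto (fun n => b n y) atTop (𝓝 0) := by
  have hle : ∀ n, b n ≤ massIterate C q n := by
    intro n
    induction n with
    | zero => exact hb0
    | succ n ih =>
      exact (hstep n).trans (smul_le_smul_of_nonneg_left (vecMul_mono hC ih) (by positivity))
  exact squeeze_zero (fun n => hb n y) (fun n => hle n y) (tendsto_massIterate hC hq hsum hno y)

/-- The triangle inequality gives `q |t| ≤ C |t|` entrywise, while the column sums give the reverse
inequality between the totals. So equality holds in every entry. -/
theorem mulVec_abs_eq_smul (hC : ∀ x y, 0 ≤ C x y) (hq : 0 < q) (hsum : ∀ y, ∑ x, C x y ≤ q)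
    {t : V → ℝ} (ht : C.mulVec t = q • t) : C.mulVec |t| = q • |t| := by
  have h1 : ∀ x, q * |t x| ≤ C.mulVec |t| x := fun x => by
    have : q * t x = ∑ y, C x y * t y := (congrFun ht x).symm
    rw [← abs_of_pos hq, ← abs_mul, this]
    refine (Finset.abs_sum_le_sum_abs _ _).trans (Finset.sum_le_sum fun y _ => ?_)
    rw [abs_mul, abs_of_nonneg (hC x y), Pi.abs_apply]
  have h2 : ∑ x, C.mulVec |t| x ≤ ∑ x, q * |t x| := by
    simp only [Matrix.mulVec, dotProduct]
    rw [Finset.sum_comm]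
    refine Finset.sum_le_sum fun y _ => ?_
    rw [← Finset.sum_mul]
    exact mul_le_mul_of_nonneg_right (hsum y) (abs_nonneg _)
  have h3 := (Finset.sum_eq_sum_iff_of_le fun x _ => h1 x).1
    (le_antisymm (Finset.sum_le_sum fun x _ => h1 x) h2)
  exact funext fun x => (h3 x (Finset.mem_univ x)).symm

end NonnegativeMatrix

/-! ### Translates of compact sets by a locally finite group: covering, overlap and volume. -/

section LatticeTilings

variable {X : Type*} [NormedAddCommGroup X]

/-- Only finitely many points of `S` lie in any given ball. -/
def IsBoundedlyFinite (S : Set X) : Prop := ∀ B : ℝ, {x ∈ S | ‖x‖ ≤ B}.Finite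

namespace IsBoundedlyFinite

variable {S : Set X}

theorem mono {S' : Set X} (h : IsBoundedlyFinite S) (hs : S' ⊆ S) : IsBoundedlyFinite S' :=
  fun B => (h B).subset fun _ hx => ⟨hs hx.1, hx.2⟩

theorem countable (h : IsBoundedlyFinite S) : S.Countable := by
  have : S = ⋃ n : ℕ, {x ∈ S | ‖x‖ ≤ n} := by
    ext x
    simp only [Set.mem_iUnion, Set.mem_ofPred_eq, exists_and_left]
    exact ⟨fun hx => ⟨hx, exists_nat_ge _⟩, fun hx => hx.1⟩
  rw [this]
  exact Set.countable_iUnion fun n => (h n).countable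

theorem isClosed (h : IsBoundedlyFinite S) : IsClosed S := by
  refine isClosed_of_closure_subset fun z hz => ?_
  have h1 : z ∈ closure (Metric.ball z 1 ∩ S) :=
    Metric.isOpen_ball.inter_closure ⟨Metric.mem_ball_self one_pos, hz⟩
  have h2 : (Metric.ball z 1 ∩ S).Finite := by
    refine (h (‖z‖ + 1)).subset fun x hx => ⟨hx.2, ?_⟩
    have h3 : ‖x - z‖ < 1 := mem_ball_iff_norm.1 hx.1
    have h4 := norm_add_le (x - z) z
    rw [sub_add_cancel] at h4
    linarith
  rw [h2.isClosed.closure_eq] at h1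
  exact h1.2

theorem isClosed_add (h : IsBoundedlyFinite S) {D : Set X} (hD : IsCompact D) :
    IsClosed (S + D) :=
  h.isClosed.add_right_of_isCompact hD

end IsBoundedlyFinite

theorem mem_add_iff_exists_mem_vadd {S D : Set X} {z : X} : z ∈ S + D ↔ ∃ x ∈ S, z ∈ x +ᵥ D := by
  simp only [Set.mem_add, Set.mem_vadd_set, vadd_eq_add]

theorem add_eq_biUnion_vadd (S D : Set X) : S + D = ⋃ x ∈ S, (x +ᵥ D) := by
  ext z
  simp [mem_add_iff_exists_mem_vadd]

/-- If `F` is self-affine and the translates of some compact set by `Λ` cover the space, so do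
the translates of `F`. -/
theorem add_eq_univ_of_selfAffine {T : X →+ X} {ρ : ℝ} (hρ : 1 < ρ) (hT : ∀ x, ρ * ‖x‖ ≤ ‖T x‖)
    {E : Set X} {Λ : AddSubgroup X}
    (hΛ : IsBoundedlyFinite (Λ : Set X))
    (hdig : ∀ x ∈ Λ, ∃ d ∈ E, ∃ y ∈ Λ, x = d + T y) {D F : Set X} (hD : IsCompact D)
    (hcov : (Λ : Set X) + D = Set.univ) (hF : IsCompact F) (hF0 : F.Nonempty)
    (hTF : T '' F = ⋃ d ∈ E, (d +ᵥ F)) : (Λ : Set X) + F = Set.univ := by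
  obtain ⟨f₀, hf₀⟩ := hF0
  obtain ⟨M, hM⟩ := hD.isBounded.exists_norm_le
  have hρ0 : 0 < ρ := one_pos.trans hρ
  -- `Λ + F` is dense: approximate `T z` and pull back through the digit expansion and the
  -- self-affine equation, which divides the error by `ρ`. The initial error comes from `D` and one
  -- point `f₀` of `F`.
  have key : ∀ (n : ℕ) (z : X), ∃ y ∈ Λ, ∃ f ∈ F, ‖z - (y + f)‖ ≤ (M + ‖f₀‖) / ρ ^ n := by
    intro n
    induction n with
    | zero =>
      intro z
      obtain ⟨x, hx, δ, hδ, rfl⟩ := Set.mem_add.1 (hcov.symm ▸ Set.mem_univ z)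
      refine ⟨x, hx, f₀, hf₀, ?_⟩
      rw [pow_zero, div_one, add_sub_add_left_eq_sub]
      exact (norm_sub_le _ _).trans (add_le_add_left (hM δ hδ) _)
    | succ n ih =>
      intro z
      obtain ⟨y, hy, f, hf, hyf⟩ := ih (T z)
      obtain ⟨d, hd, y', hy', rfl⟩ := hdig y hy
      have h1 : d + f ∈ T '' F := hTF ▸ Set.mem_biUnion hd (Set.vadd_mem_vadd_set hf)
      obtain ⟨f', hf', hdf⟩ := h1
      refine ⟨y', hy', f', hf', ?_⟩
      have h2 : T (z - (y' + f')) = T z - (d + T y' + f) := by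
        rw [map_sub, map_add, hdf]; abel
      rw [pow_succ, ← div_div, le_div_iff₀ hρ0, mul_comm]
      exact (hT _).trans (h2 ▸ hyf)
  refine Set.eq_univ_of_forall fun z => (hΛ.isClosed_add hF).closure_subset ?_
  refine Metric.mem_closure_iff.2 fun ε hε => ?_
  have hlim : Tendsto (fun n : ℕ => (M + ‖f₀‖) / ρ ^ n) atTop (𝓝 0) :=
    (tendsto_pow_atTop_atTop_of_one_lt hρ).const_div_atTop _
  obtain ⟨n, hn⟩ := (hlim.eventually (gt_mem_nhds hε)).exists
  obtain ⟨y, hy, f, hf, hyf⟩ := key n z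
  exact ⟨y + f, Set.add_mem_add hy hf, by rw [dist_eq_norm]; exact hyf.trans_lt hn⟩

theorem iterate_image_eq_biUnion [DecidableEq X] {T : X →+ X} {E : Finset X} {F : Set X}
    (hTF : T '' F = ⋃ d ∈ E, (d +ᵥ F)) (n : ℕ) :
    T^[n] '' F = ⋃ e ∈ digitSums T E n, (e +ᵥ F) := by
  induction n with
  | zero => simp [digitSums_zero]
  | succ n ih =>
    rw [Function.iterate_succ', Set.image_comp, ih, Set.image_iUnion₂]
    have h1 : ∀ e, T '' (e +ᵥ F) = ⋃ d ∈ E, ((d + T e) +ᵥ F) := by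
      intro e
      have h2 : T '' (e +ᵥ F) = T e +ᵥ T '' F := by
        rw [← Set.image_vadd, ← Set.image_vadd, Set.image_image, Set.image_image]
        simp
      rw [h2, hTF, Set.vadd_set_iUnion₂]
      simp only [vadd_vadd, add_comm]
    simp only [h1]
    ext z
    simp only [Set.mem_iUnion, mem_digitSums_succ]
    constructor
    · rintro ⟨e, he, d, hd, hz⟩
      exact ⟨d + T e, ⟨d, hd, e, he, rfl⟩, hz⟩
    · rintro ⟨_, ⟨d, hd, e, he, rfl⟩, hz⟩
      exact ⟨e, he, d, hd, hz⟩

/-- A tiling is a collection of sets, so distinct `x` might a priori index the same translate. If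
they did, all multiples of a nonzero lattice element would be bounded, which local finiteness
forbids. -/
theorem vadd_ne_self_of_isBoundedlyFinite {Λ : AddSubgroup X} (hΛ : IsBoundedlyFinite (Λ : Set X))
    {D : Set X} (hD : IsCompact D) (hD0 : D.Nonempty) {x : X} (hx : x ∈ Λ)
    (htf : ∀ n : ℕ, n • x = 0 → n = 0) : x +ᵥ D ≠ D := by
  intro heq
  obtain ⟨M, hM⟩ := hD.isBounded.exists_norm_le
  obtain ⟨δ, hδ⟩ := hD0
  have h1 : ∀ n : ℕ, n • x + δ ∈ D := by
    intro n
    induction n with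
    | zero => simpa using hδ
    | succ n ih =>
      rw [← heq]
      exact ⟨n • x + δ, ih, by
        change x + (n • x + δ) = _
        rw [succ_nsmul]; abel⟩
  refine Set.infinite_range_of_injective (f := fun n : ℕ => n • x) ?_
    ((hΛ (M + M)).subset ?_)
  · intro m n hmn
    rcases le_total m n with h | h
    · have := htf (n - m) (by rw [sub_nsmul x h]; simp [show n • x = m • x from hmn.symm])
      omega
    · have := htf (m - n) (by rw [sub_nsmul x h]; simp [show m • x = n • x from hmn])
      omega
  · rintro _ ⟨n, rfl⟩
    refine ⟨Λ.nsmul_mem hx n, ?_⟩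
    have h2 := norm_sub_le (n • x + δ) δ
    rw [add_sub_cancel_right] at h2
    exact h2.trans (add_le_add (hM _ (h1 n)) (hM _ hδ))

variable [MeasurableSpace X] {μ : Measure X}

/-- The translates of the compact set `D` by `Λ` cover `X` and are almost disjoint. -/
structure IsLatticeTile (μ : Measure X) (Λ : AddSubgroup X) (D : Set X) : Prop where
  isCompact : IsCompact D
  cover : (Λ : Set X) + D = Set.univ
  overlap : ∀ x ∈ Λ, x ≠ 0 → μ (D ∩ (x +ᵥ D)) = 0

theorem measure_vadd_inter_vadd [μ.IsAddLeftInvariant] (A B : Set X) (x y : X) :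
    μ ((x +ᵥ A) ∩ (y +ᵥ B)) = μ (((x - y) +ᵥ A) ∩ B) := by
  rw [← measure_vadd μ y (((x - y) +ᵥ A) ∩ B), Set.vadd_set_inter, vadd_vadd, add_sub_cancel]

theorem measure_inter_vadd_eq_zero_of_vadd [μ.IsAddLeftInvariant] {F : Set X} {e e' : X}
    (h : μ ((e +ᵥ F) ∩ (e' +ᵥ F)) = 0) : μ (F ∩ ((e' - e) +ᵥ F)) = 0 := by
  rwa [Set.inter_comm, measure_vadd_inter_vadd, Set.inter_comm] at h

theorem measure_ne_zero_of_add_eq_univ [μ.IsAddLeftInvariant] [NeZero μ] {S D : Set X}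
    (hS : S.Countable) (h : S + D = Set.univ) : μ D ≠ 0 := by
  intro h0
  have : μ (S + D) = 0 := by
    rw [add_eq_biUnion_vadd]
    exact (measure_biUnion_null_iff hS).2 fun x _ => by rw [measure_vadd, h0]
  rw [h] at this
  exact NeZero.ne μ (Measure.measure_univ_eq_zero.1 this)

theorem IsLatticeTile.aedisjoint [μ.IsAddLeftInvariant] {Λ : AddSubgroup X} {D : Set X}
    (h : IsLatticeTile μ Λ D) {x y : X} (hx : x ∈ Λ) (hy : y ∈ Λ) (hne : x ≠ y) :
    AEDisjoint μ (x +ᵥ D) (y +ᵥ D) := by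
  change μ _ = 0
  rw [measure_vadd_inter_vadd, Set.inter_comm]
  exact h.overlap _ (Λ.sub_mem hx hy) (sub_ne_zero.2 hne)

/-- Almost every point lies in exactly one member of the collection of translates. -/
def AlmostPartition (μ : Measure X) (Λ : AddSubgroup X) (D : Set X) : Prop :=
  ∀ᵐ z ∂μ, {S | S ∈ (fun x => x +ᵥ D) '' (Λ : Set X) ∧ z ∈ S}.encard = 1

theorem IsLatticeTile.almostPartition [μ.IsAddLeftInvariant] {Λ : AddSubgroup X}
    (hΛ : IsBoundedlyFinite (Λ : Set X)) {D : Set X} (h : IsLatticeTile μ Λ D) :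
    AlmostPartition μ Λ D := by
  have : Countable Λ := hΛ.countable.to_subtype
  have hae : ∀ᵐ z ∂μ, ∀ x y : Λ, x ≠ y → ¬ (z ∈ (x : X) +ᵥ D ∧ z ∈ (y : X) +ᵥ D) := by
    refine ae_all_iff.2 fun x => ae_all_iff.2 fun y => ?_
    by_cases hxy : x = y
    · exact Eventually.of_forall fun z hne => absurd hxy hne
    have h1 : μ (((x : X) +ᵥ D) ∩ ((y : X) +ᵥ D)) = 0 :=
      h.aedisjoint x.2 y.2 fun h2 => hxy (Subtype.ext h2)
    have h2 : ∀ᵐ z ∂μ, ¬ (z ∈ (x : X) +ᵥ D ∧ z ∈ (y : X) +ᵥ D) := by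
      rw [ae_iff]
      simp only [not_not]
      exact h1
    filter_upwards [h2] with z hz _ using hz
  filter_upwards [hae] with z hz
  obtain ⟨x, hx, hzx⟩ := mem_add_iff_exists_mem_vadd.1 (h.cover.symm ▸ Set.mem_univ z)
  refine Set.encard_eq_one.2 ⟨x +ᵥ D, Set.eq_singleton_iff_unique_mem.2 ⟨⟨⟨x, hx, rfl⟩, hzx⟩, ?_⟩⟩
  rintro _ ⟨⟨y, hy, rfl⟩, hzy⟩
  by_contra hne
  refine hz ⟨y, hy⟩ ⟨x, hx⟩ (fun h2 => hne ?_) ⟨hzy, hzx⟩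
  rw [Subtype.mk.injEq] at h2
  simp only [h2]

/-- Almost covering is covering, because `Λ + D` is closed and its complement is an open null set.
-/
theorem AlmostPartition.isLatticeTile [μ.IsAddHaarMeasure] {Λ : AddSubgroup X}
    (hΛ : IsBoundedlyFinite (Λ : Set X)) (htf : ∀ x ∈ Λ, x ≠ 0 → ∀ n : ℕ, n • x = 0 → n = 0)
    {D : Set X} (hD : IsCompact D) (h : AlmostPartition μ Λ D) : IsLatticeTile μ Λ D := by
  have hex : ∀ᵐ z ∂μ, z ∈ (Λ : Set X) + D := by
    filter_upwards [h] with z hz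
    obtain ⟨S, hS⟩ := Set.encard_eq_one.1 hz
    obtain ⟨⟨x, hx, rfl⟩, hzS⟩ : S ∈ {S | S ∈ (fun x => x +ᵥ D) '' (Λ : Set X) ∧ z ∈ S} :=
      hS ▸ Set.mem_singleton S
    exact mem_add_iff_exists_mem_vadd.2 ⟨x, hx, hzS⟩
  have hcov : (Λ : Set X) + D = Set.univ := by
    have h1 : IsOpen ((Λ : Set X) + D)ᶜ := (hΛ.isClosed_add hD).isOpen_compl
    exact Set.compl_empty_iff.1 (h1.eq_empty_of_measure_zero (μ := μ) hex)
  have hne : D.Nonempty := by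
    obtain ⟨x, -, δ, hδ, -⟩ := Set.mem_add.1 (hcov.symm ▸ Set.mem_univ (0 : X))
    exact ⟨δ, hδ⟩
  refine ⟨hD, hcov, fun x hx hx0 => ?_⟩
  have hsub : ∀ᵐ z ∂μ, z ∉ D ∩ (x +ᵥ D) := by
    filter_upwards [h] with z hz hzD
    obtain ⟨S, hS⟩ := Set.encard_eq_one.1 hz
    have h1 : D ∈ ({S} : Set (Set X)) := hS ▸ ⟨⟨0, Λ.zero_mem, by simp⟩, hzD.1⟩
    have h2 : x +ᵥ D ∈ ({S} : Set (Set X)) := hS ▸ ⟨⟨x, hx, rfl⟩, hzD.2⟩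
    exact vadd_ne_self_of_isBoundedlyFinite hΛ hD hne hx (htf x hx hx0)
      ((Set.mem_singleton_iff.1 h2).trans (Set.mem_singleton_iff.1 h1).symm)
  simpa [ae_iff] using hsub

variable [BorelSpace X]

/-- Pairwise incongruent elements of `Λ` modulo `T Λ` give almost disjoint translates of `D` that
pack modulo `T Λ`, whereas `T D` covers modulo `T Λ`. -/
theorem IsLatticeTile.card_mul_measure_le [μ.IsAddLeftInvariant] {Λ : AddSubgroup X} {D : Set X}
    (h : IsLatticeTile μ Λ D) (hΛ : IsBoundedlyFinite (Λ : Set X)) {T : X →+ X}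
    (hTb : Function.Bijective T) (hTc : Continuous T) (hTΛ : ∀ x ∈ Λ, T x ∈ Λ) {S : Finset X}
    (hS : ∀ s ∈ S, s ∈ Λ) (hinc : ∀ s ∈ S, ∀ s' ∈ S, ∀ x ∈ Λ, s = s' + T x → s = s') :
    S.card * μ D ≤ μ (T '' D) := by
  have : Countable Λ := hΛ.countable.to_subtype
  have hTD : MeasurableSet (T '' D) := (h.isCompact.image hTc).isClosed.measurableSet
  have hcov : ∀ z : X, ∃ x : Λ, z ∈ T x +ᵥ T '' D := by
    intro z
    obtain ⟨w, rfl⟩ := hTb.2 z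
    obtain ⟨x, hx, δ, hδ, rfl⟩ := Set.mem_add.1 (h.cover.symm ▸ Set.mem_univ w)
    exact ⟨⟨x, hx⟩, by rw [map_add]; exact Set.vadd_mem_vadd_set (Set.mem_image_of_mem _ hδ)⟩
  -- The translates of `T D` by `T Λ` cover, so `s + D` is cut into pieces that are moved into `T
  -- D`.
  have h1 : ∀ s : S, μ D ≤ ∑' x : Λ, μ ((((s : X) - T x) +ᵥ D) ∩ T '' D) := by
    intro s
    calc μ D = μ ((s : X) +ᵥ D) := (measure_vadd _ _ _).symm
      _ ≤ μ (⋃ x : Λ, ((s : X) +ᵥ D) ∩ (T x +ᵥ T '' D)) := measure_mono fun z hz =>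
          let ⟨x, hx⟩ := hcov z
          Set.mem_iUnion.2 ⟨x, hz, hx⟩
      _ ≤ ∑' x : Λ, μ (((s : X) +ᵥ D) ∩ (T x +ᵥ T '' D)) := measure_iUnion_le _
      _ = _ := by simp only [measure_vadd_inter_vadd]
  have hmem : ∀ p : S × Λ, (p.1 : X) - T p.2 ∈ Λ := fun p =>
    Λ.sub_mem (hS _ p.1.2) (hTΛ _ p.2.2)
  -- By incongruence, the moved pieces lie in different `Λ`-translates of `D`, so they are almost
  -- disjoint and their measures add up inside `T D`.
  have hinj : ∀ p p' : S × Λ, p ≠ p' → (p.1 : X) - T p.2 ≠ p'.1 - T p'.2 := by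
    rintro ⟨s, x⟩ ⟨s', x'⟩ hne heq
    refine hne ?_
    have h2 : (s : X) = s' := hinc s s.2 s' s'.2 (x - x') (Λ.sub_mem x.2 x'.2) (by
      rw [map_sub, eq_add_of_sub_eq heq]; abel)
    rw [h2] at heq
    exact Prod.ext (Subtype.ext h2) (Subtype.ext (hTb.1 (sub_right_injective heq)))
  calc S.card * μ D = ∑ _s : S, μ D := by simp
    _ ≤ ∑ s : S, ∑' x : Λ, μ ((((s : X) - T x) +ᵥ D) ∩ T '' D) :=
        Finset.sum_le_sum fun s _ => h1 s
    _ = ∑' p : S × Λ, μ ((((p.1 : X) - T p.2) +ᵥ D) ∩ T '' D) := by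
        rw [ENNReal.tsum_prod', tsum_fintype]
    _ = μ (⋃ p : S × Λ, (((p.1 : X) - T p.2) +ᵥ D) ∩ T '' D) := by
        refine (measure_iUnion₀ (fun p p' hne => ?_) fun p => ?_).symm
        · exact (h.aedisjoint (hmem p) (hmem p') (hinj p p' hne)).mono
            Set.inter_subset_left Set.inter_subset_left
        · exact ((h.isCompact.vadd _).isClosed.measurableSet.inter hTD).nullMeasurableSet
    _ ≤ μ (T '' D) := measure_mono (Set.iUnion_subset fun p => Set.inter_subset_right)

/-- Any overlap of two pieces would push the measure of the union strictly below the total of the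
measures, which is finite. -/
theorem measure_inter_eq_zero_of_card_mul_le [μ.IsAddLeftInvariant] {F : Set X} (hF : IsCompact F)
    (hfin : μ F ≠ ⊤) {S : Finset X} (hS : S.card * μ F ≤ μ (⋃ s ∈ S, (s +ᵥ F))) {a b : X}
    (ha : a ∈ S) (hb : b ∈ S) (hab : a ≠ b) : μ ((a +ᵥ F) ∩ (b +ᵥ F)) = 0 := by
  classical
  have hb' : b ∈ S.erase a := Finset.mem_erase.2 ⟨hab.symm, hb⟩
  set S' := (S.erase a).erase b
  have hcard : S.card = S'.card + 2 := by
    rw [Finset.card_erase_of_mem hb', Finset.card_erase_of_mem ha]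
    have : 1 < S.card := Finset.one_lt_card.2 ⟨a, ha, b, hb, hab⟩
    omega
  have hsub : ⋃ s ∈ S, (s +ᵥ F) ⊆ ((a +ᵥ F) ∪ (b +ᵥ F)) ∪ ⋃ s ∈ S', (s +ᵥ F) := by
    refine Set.iUnion₂_subset fun s hs z hz => ?_
    by_cases h1 : s = a
    · exact Or.inl (Or.inl (h1 ▸ hz))
    by_cases h2 : s = b
    · exact Or.inl (Or.inr (h2 ▸ hz))
    exact Or.inr (Set.mem_biUnion (Finset.mem_erase.2 ⟨h2, Finset.mem_erase.2 ⟨h1, hs⟩⟩) hz)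
  have h1 : μ (⋃ s ∈ S', (s +ᵥ F)) ≤ S'.card * μ F := by
    refine (measure_biUnion_finset_le S' _).trans ?_
    simp [measure_vadd]
  have h2 : μ ((a +ᵥ F) ∪ (b +ᵥ F)) + μ ((a +ᵥ F) ∩ (b +ᵥ F)) = μ F + μ F := by
    rw [measure_union_add_inter _ (hF.vadd b).isClosed.measurableSet, measure_vadd, measure_vadd]
  have h3 : S.card * μ F + μ ((a +ᵥ F) ∩ (b +ᵥ F)) ≤ S.card * μ F := by
    calc S.card * μ F + μ ((a +ᵥ F) ∩ (b +ᵥ F))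
        ≤ (μ ((a +ᵥ F) ∪ (b +ᵥ F)) + S'.card * μ F) + μ ((a +ᵥ F) ∩ (b +ᵥ F)) := by
          gcongr
          exact hS.trans ((measure_mono hsub).trans ((measure_union_le _ _).trans (by gcongr)))
      _ = (μ F + μ F) + S'.card * μ F := by rw [← h2]; abel
      _ = S.card * μ F := by rw [hcard]; push_cast; ring
  have h4 : (S.card : ENNReal) * μ F ≠ ⊤ := ENNReal.mul_ne_top (by simp) hfin
  have h5 : (S.card : ENNReal) * μ F + μ ((a +ᵥ F) ∩ (b +ᵥ F)) ≤ S.card * μ F + 0 := by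
    rwa [add_zero]
  exact nonpos_iff_eq_zero.1 ((ENNReal.add_le_add_iff_left h4).1 h5)

end LatticeTilings

/-! ### Measure, expansion, discreteness and connectedness in `𝕂_α`. -/

section RepresentationSpaceGeometry

open scoped Classical

variable {K : Type*} [Field K] [NumberField K]

theorem countable_numberField : Countable K :=
  (Module.finBasis ℚ K).equivFun.toEquiv.countable_iff.2 inferInstance

instance secondCountableTopology_completion (v : HeightOneSpectrum (𝓞 K)) :
    SecondCountableTopology (v.adicCompletion K) := by
  have : Countable K := countable_numberField
  have : TopologicalSpace.SeparableSpace (v.adicCompletion K) :=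
    ⟨_, Set.countable_range (algebraMap K (v.adicCompletion K)), v.denseRange_algebraMap K⟩
  exact UniformSpace.secondCountable_of_separable _

instance locallyCompactSpace_completion (v : HeightOneSpectrum (𝓞 K)) :
    LocallyCompactSpace (v.adicCompletion K) :=
  (integersCompacts v).locallyCompactSpace_of_addGroup

instance isAddHaarMeasure_haarCompletion (v : HeightOneSpectrum (𝓞 K)) :
    (haarCompletion v).IsAddHaarMeasure := by
  unfold haarCompletion
  infer_instance

instance isAddHaarMeasure_repMeasure (α : K) : (repMeasure α).IsAddHaarMeasure := by
  have h : (Measure.pi fun v : DenomPrime α => haarCompletion v.1).IsAddHaarMeasure := by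
    have : ∀ v : DenomPrime α, SigmaFinite (haarCompletion v.1) := fun v => inferInstance
    exact Measure.pi.isAddHaarMeasure _
  exact Measure.prod.instIsAddHaarMeasure _ _

/-- Multiplication by `Φ_α(ξ)` on `𝕂_α`. -/
noncomputable def mulDiag (α ξ : K) : RepSpace α →+ RepSpace α := AddMonoidHom.mulLeft (diag α ξ)

theorem mulDiag_apply (α ξ : K) (z : RepSpace α) : mulDiag α ξ z = diag α ξ * z := rfl

theorem mulDiag_diag (α ξ x : K) : mulDiag α ξ (diag α x) = diag α (ξ * x) := by
  rw [mulDiag_apply, map_mul]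

theorem continuous_mulDiag (α ξ : K) : Continuous (mulDiag α ξ) := by
  change Continuous fun z => diag α ξ * z
  fun_prop

theorem mulDiag_inv_mulDiag (α : K) {ξ : K} (hξ : ξ ≠ 0) (z : RepSpace α) :
    mulDiag α ξ⁻¹ (mulDiag α ξ z) = z := by
  rw [mulDiag_apply, mulDiag_apply, ← mul_assoc, ← map_mul, inv_mul_cancel₀ hξ, map_one, one_mul]

theorem mulDiag_mulDiag_inv (α : K) {ξ : K} (hξ : ξ ≠ 0) (z : RepSpace α) :
    mulDiag α ξ (mulDiag α ξ⁻¹ z) = z := by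
  rw [mulDiag_apply, mulDiag_apply, ← mul_assoc, ← map_mul, mul_inv_cancel₀ hξ, map_one, one_mul]

theorem bijective_mulDiag (α : K) {ξ : K} (hξ : ξ ≠ 0) : Function.Bijective (mulDiag α ξ) :=
  Function.bijective_iff_has_inverse.2
    ⟨mulDiag α ξ⁻¹, mulDiag_inv_mulDiag α hξ, mulDiag_mulDiag_inv α hξ⟩

theorem diag_injective (α : K) : Function.Injective (diag α) := fun _ _ h =>
  mixedEmbedding_injective K (congrArg Prod.fst h)

/-- Multiplication by `Φ_α(ξ)` scales the Haar measure by a constant factor. -/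
theorem exists_measure_image_mulDiag (α : K) {ξ : K} (hξ : ξ ≠ 0) :
    ∃ m : NNReal, ∀ S : Set (RepSpace α), IsCompact S →
      repMeasure α (mulDiag α ξ '' S) = m * repMeasure α S := by
  -- The forward map is multiplication by `ξ⁻¹`, so that preimages in the pushforward are images
  -- under multiplication by `ξ`.
  let e : RepSpace α ≃+ RepSpace α :=
    { toFun := mulDiag α ξ⁻¹
      invFun := mulDiag α ξ
      left_inv := mulDiag_mulDiag_inv α hξ
      right_inv := mulDiag_inv_mulDiag α hξ
      map_add' := map_add _ }
  have hH := e.isAddHaarMeasure_map (repMeasure α) (continuous_mulDiag α ξ⁻¹) (continuous_mulDiag α ξ)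
  refine ⟨Measure.addHaarScalarFactor (Measure.map e (repMeasure α)) (repMeasure α), fun S hS => ?_⟩
  have h := Measure.measure_isAddInvariant_eq_smul_of_isCompact_closure
    (Measure.map e (repMeasure α)) (repMeasure α) (s := S) hS.closure
  rw [Measure.map_apply (f := e) (continuous_mulDiag α ξ⁻¹).measurable
    hS.isClosed.measurableSet] at h
  rw [ENNReal.smul_def, smul_eq_mul] at h
  rw [← h]
  congr 1
  exact (e.symm.toEquiv.image_eq_preimage_symm S)

theorem exists_one_lt_forall_le {ι : Type*} [Finite ι] (f : ι → ℝ) (h : ∀ i, 1 < f i) :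
    ∃ ρ > 1, ∀ i, ρ ≤ f i := by
  cases isEmpty_or_nonempty ι
  · exact ⟨2, one_lt_two, fun i => isEmptyElim i⟩
  · obtain ⟨i, hi⟩ := Finite.exists_min f
    exact ⟨f i, h i, hi⟩

theorem norm_algebraMap_completion_lt {v : HeightOneSpectrum (𝓞 K)} {x y : K} :
    ‖algebraMap K (v.adicCompletion K) x‖ < ‖algebraMap K (v.adicCompletion K) y‖ ↔
      v.valuation K x < v.valuation K y := by
  rw [FinitePlace.norm_def, FinitePlace.norm_def, NNReal.coe_lt_coe,
    (WithZeroMulInt.toNNReal_strictMono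
    (HeightOneSpectrum.one_lt_absNorm_nnreal v)).lt_iff_lt,
    ← HeightOneSpectrum.valuedAdicCompletion_eq_valuation' v x,
    ← HeightOneSpectrum.valuedAdicCompletion_eq_valuation' v y]
  rfl

theorem one_lt_norm_algebraMap_completion {v : HeightOneSpectrum (𝓞 K)} {x : K} :
    1 < ‖algebraMap K (v.adicCompletion K) x‖ ↔ 1 < v.valuation K x := by
  have := norm_algebraMap_completion_lt (v := v) (x := 1) (y := x)
  simpa using this

/-- Multiplication by `α` expands `𝕂_α`. -/
theorem exists_expansion (α : K) (hα : ∀ φ : K →+* ℂ, 1 < ‖φ α‖) :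
    ∃ ρ : ℝ, 1 < ρ ∧ ∀ z : RepSpace α, ρ * ‖z‖ ≤ ‖mulDiag α α z‖ := by
  obtain ⟨ρ₁, h₁, hρ₁⟩ := exists_one_lt_forall_le (fun w : InfinitePlace K => w α) fun w => by
    rw [← w.norm_embedding_eq]; exact hα _
  obtain ⟨ρ₂, h₂, hρ₂⟩ := exists_one_lt_forall_le
    (fun v : DenomPrime α => ‖algebraMap K (v.1.adicCompletion K) α‖) fun v =>
      one_lt_norm_algebraMap_completion.2 v.2
  refine ⟨min ρ₁ ρ₂, lt_min h₁ h₂, fun z => ?_⟩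
  have hρ : 0 < min ρ₁ ρ₂ := one_pos.trans (lt_min h₁ h₂)
  rw [mul_comm, ← le_div_iff₀ hρ]
  refine norm_prod_le_iff.2 ⟨?_, ?_⟩
  · rw [norm_eq_sup'_normAtPlace]
    refine Finset.sup'_le _ _ fun w _ => ?_
    rw [le_div_iff₀ hρ]
    calc normAtPlace w z.1 * min ρ₁ ρ₂ ≤ normAtPlace w z.1 * w α := by
          gcongr
          · exact normAtPlace_nonneg w _
          · exact (min_le_left _ _).trans (hρ₁ w)
      _ = normAtPlace w (mulDiag α α z).1 := by
          change _ = normAtPlace w (mixedEmbedding K α * z.1)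
          rw [map_mul, normAtPlace_apply, mul_comm]
      _ ≤ ‖(mulDiag α α z).1‖ := by
          rw [norm_eq_sup'_normAtPlace]
          exact Finset.le_sup' (fun w => normAtPlace w (mulDiag α α z).1) (Finset.mem_univ w)
      _ ≤ ‖mulDiag α α z‖ := norm_fst_le _
  · refine (pi_norm_le_iff_of_nonneg (by positivity)).2 fun v => ?_
    rw [le_div_iff₀ hρ]
    calc ‖z.2 v‖ * min ρ₁ ρ₂ ≤ ‖z.2 v‖ * ‖algebraMap K (v.1.adicCompletion K) α‖ := by
          gcongr
          exact (min_le_right _ _).trans (hρ₂ v)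
      _ = ‖(mulDiag α α z).2 v‖ := by
          change _ = ‖algebraMap K (v.1.adicCompletion K) α * z.2 v‖
          rw [norm_mul, mul_comm]
      _ ≤ ‖(mulDiag α α z).2‖ := norm_le_pi_norm _ v
      _ ≤ ‖mulDiag α α z‖ := norm_snd_le _

/-- The product of the rational primes below the primes `𝔭 ∣ 𝔟`. -/
noncomputable def denomNat (α : K) : ℕ := ∏ v : DenomPrime α, primeBelow v.1

theorem denomNat_pos (α : K) : 0 < denomNat α :=
  Finset.prod_pos fun v _ => (fact_primeBelow v.1).out.pos

theorem norm_denomNat_lt_one (α : K) (v : DenomPrime α) :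
    ‖(denomNat α : v.1.adicCompletion K)‖ < 1 := by
  have h : (denomNat α : v.1.adicCompletion K) =
      algebraMap ℚ (v.1.adicCompletion K) ((denomNat α : ℤ) : ℚ) := by simp
  rw [h, norm_lt_one_iff, valued_intCast_lt_one_iff]
  exact_mod_cast Finset.dvd_prod_of_mem (fun v : DenomPrime α => primeBelow v.1) (Finset.mem_univ v)

theorem exists_norm_denomNat_pow_mul_lt (α : K) (B : ℝ) {ε : ℝ} (hε : 0 < ε) :
    ∃ k : ℕ, ∀ v : DenomPrime α, ‖(denomNat α : v.1.adicCompletion K)‖ ^ k * B < ε := by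
  have h : ∀ v : DenomPrime α, ∀ᶠ k : ℕ in atTop,
      ‖(denomNat α : v.1.adicCompletion K)‖ ^ k * B < ε := fun v => by
    have h1 := (tendsto_pow_atTop_nhds_zero_of_lt_one (norm_nonneg _)
      (norm_denomNat_lt_one α v)).mul_const B
    rw [zero_mul] at h1
    exact h1.eventually (gt_mem_nhds hε)
  exact (eventually_all.2 h).exists

theorem valuation_adjoin_le_one {α x : K} (hx : x ∈ Algebra.adjoin ℤ {α})
    {v : HeightOneSpectrum (𝓞 K)} (hv : v.valuation K α ≤ 1) : v.valuation K x ≤ 1 := by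
  induction hx using Algebra.adjoin_induction with
  | mem y hy => rwa [Set.mem_singleton_iff.1 hy]
  | algebraMap n =>
    have : (algebraMap ℤ K n) = algebraMap (𝓞 K) K n := by simp
    rw [this]
    exact v.valuation_le_one _
  | add y z _ _ hy hz => exact (Valuation.map_add _ _ _).trans (max_le hy hz)
  | mul y z _ _ hy hz => rw [map_mul]; exact mul_le_one' hy hz

/-- A fixed power `N` of `denomNat α` makes every `x ∈ ℤ[α]` with `‖Φ_α(x)‖ ≤ B` integral: at `𝔭 ∣
𝔟` by the choice of `N`, at all other primes because `α` is integral there. The conjugates of `N x`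
are bounded, which leaves finitely many algebraic integers. -/
theorem isBoundedlyFinite_diag_adjoin (α : K) :
    IsBoundedlyFinite (diag α '' (Algebra.adjoin ℤ {α} : Set K)) := by
  intro B
  obtain ⟨k, hk⟩ := exists_norm_denomNat_pow_mul_lt α B one_pos
  set N : ℕ := denomNat α ^ k with hN
  have hN0 : (N : K) ≠ 0 := by
    rw [hN]; exact_mod_cast (pow_pos (denomNat_pos α) k).ne'
  have hfin := (Embeddings.finite_of_norm_le K ℂ (N * B)).image fun x : K => diag α ((N : K)⁻¹ * x)
  refine hfin.subset ?_
  rintro _ ⟨⟨x, hx, rfl⟩, hxB⟩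
  refine ⟨N * x, ⟨?_, ?_⟩, congrArg (diag α) (inv_mul_cancel_left₀ hN0 x)⟩
  · have hint : (N : K) * x ∈ (algebraMap (𝓞 K) K).range := by
      refine HeightOneSpectrum.mem_integers_of_valuation_le_one K _ fun v => ?_
      by_cases hv : v.valuation K α ≤ 1
      · rw [map_mul]
        refine mul_le_one' ?_ (valuation_adjoin_le_one hx hv)
        have : (N : K) = algebraMap (𝓞 K) K N := by simp
        rw [this]
        exact v.valuation_le_one _
      · have h1 := hk ⟨v, not_le.1 hv⟩
        have h2 : ‖algebraMap K (v.adicCompletion K) x‖ ≤ B :=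
          (norm_le_pi_norm (diag α x).2 ⟨v, not_le.1 hv⟩).trans ((norm_snd_le _).trans hxB)
        have h3 : ‖algebraMap K (v.adicCompletion K) (N * x)‖ < 1 := by
          rw [map_mul, norm_mul, map_natCast, hN, Nat.cast_pow, norm_pow]
          exact lt_of_le_of_lt (by gcongr) h1
        exact not_lt.1 fun h4 => h3.not_gt (one_lt_norm_algebraMap_completion.2 h4)
    obtain ⟨y, hy⟩ := hint
    rw [← hy]
    exact y.isIntegral_coe
  · refine (InfinitePlace.le_iff_le _ _).1 fun w => ?_
    rw [map_mul]
    have h1 : w x ≤ B := by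
      rw [← normAtPlace_apply]
      refine le_trans ?_ ((norm_fst_le (diag α x)).trans hxB)
      rw [norm_eq_sup'_normAtPlace]
      exact Finset.le_sup' (fun w => normAtPlace w (diag α x).1) (Finset.mem_univ w)
    have h2 : w (N : K) = N := by rw [← w.norm_embedding_eq, map_natCast, Complex.norm_natCast]
    rw [h2]
    gcongr

/-- The fibre over a point of the finite part is a copy of the connected space `𝕂_∞`. -/
theorem mem_of_isClopen_of_snd_eq {α : K} {U : Set (RepSpace α)} (hU : IsClopen U)
    {u z : RepSpace α} (hu : u ∈ U) (hz : z.2 = u.2) : z ∈ U := by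
  have h1 : IsClopen ((fun a : mixedSpace K => ((a, u.2) : RepSpace α)) ⁻¹' U) :=
    hU.preimage (by fun_prop)
  have h2 : z.1 ∈ (fun a : mixedSpace K => ((a, u.2) : RepSpace α)) ⁻¹' U :=
    h1.eq_univ ⟨u.1, hu⟩ ▸ Set.mem_univ z.1
  rw [← hz] at h2
  exact h2

/-- A nonempty clopen subset of `𝕂_α` that is invariant under a cocompact subgroup is everything:
it is invariant under translation by `𝕂_∞`, and the projection of a cocompact subgroup to `𝕂_𝔟` is
dense. -/
theorem eq_univ_of_isClopen_of_cocompact (α : K) {U : Set (RepSpace α)} (hU : IsClopen U)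
    (hU0 : U.Nonempty) {H : AddSubgroup (RepSpace α)} (hHU : ∀ h ∈ H, ∀ u ∈ U, h + u ∈ U)
    {C : Set (RepSpace α)} (hC : IsCompact C) (hcov : (H : Set (RepSpace α)) + C = Set.univ) :
    U = Set.univ := by
  obtain ⟨u, hu⟩ := hU0
  obtain ⟨B, hB⟩ := hC.isBounded.exists_norm_le
  refine Set.eq_univ_of_forall fun z => hU.isClosed.closure_subset (Metric.mem_closure_iff.2 ?_)
  intro ε hε
  obtain ⟨k, hk⟩ := exists_norm_denomNat_pow_mul_lt α B hε
  set N : ℕ := denomNat α ^ k with hN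
  have hN0 : ∀ v : DenomPrime α, (N : v.1.adicCompletion K) ≠ 0 := fun v => by
    rw [hN]
    have : CharZero (v.1.adicCompletion K) := algebraRat.charZero _
    exact_mod_cast (pow_pos (denomNat_pos α) k).ne'
  -- Chosen so that `N w = z - u` in the finite part. Writing `w = h + c` with `h ∈ H`, `c ∈ C`, the
  -- point `N h + u` of `U` differs from `z` there by `N c`, which is smaller than `ε`.
  let w : RepSpace α := (0, fun v => (N : v.1.adicCompletion K)⁻¹ * (z.2 v - u.2 v))
  obtain ⟨h, hh, c, hc, hw⟩ := Set.mem_add.1 (hcov.symm ▸ Set.mem_univ w)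
  have h1 : N • h + u ∈ U := hHU _ (H.nsmul_mem hh N) _ hu
  refine ⟨(z.1, (N • h + u).2), mem_of_isClopen_of_snd_eq hU h1 rfl, ?_⟩
  rw [dist_eq_norm]
  have h2 : ∀ v : DenomPrime α, z.2 v - (N • h + u).2 v = N * c.2 v := by
    intro v
    have h3 : h.2 v + c.2 v = (N : v.1.adicCompletion K)⁻¹ * (z.2 v - u.2 v) :=
      congrFun (congrArg Prod.snd hw) v
    have h4 : (N • h + u).2 v = N * h.2 v + u.2 v := by
      simp
    rw [h4, ← sub_eq_zero]
    have h5 : (N : v.1.adicCompletion K) * (h.2 v + c.2 v) = z.2 v - u.2 v := by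
      rw [h3, mul_inv_cancel_left₀ (hN0 v)]
    linear_combination -h5
  have h6 : z - (z.1, (N • h + u).2) =
      ((0, fun v => N * c.2 v) : RepSpace α) :=
    Prod.ext (sub_self _) (funext h2)
  rw [h6]
  refine max_lt (by simpa using hε) ?_
  refine (pi_norm_lt_iff hε).2 fun v => lt_of_le_of_lt ?_ (hk v)
  change ‖(N : v.1.adicCompletion K) * c.2 v‖ ≤ _
  rw [hN, Nat.cast_pow, norm_mul, norm_pow]
  gcongr
  exact (norm_le_pi_norm c.2 v).trans ((norm_snd_le c).trans (hB c hc))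

end RepresentationSpaceGeometry

/-! ### The minimal polynomial and the number of digits. -/

section DigitSets

variable {K : Type*} [Field K] {α : K} {A : Polynomial ℤ} {𝒟 : Set K}

theorem IsExpanding.one_lt_norm_embedding (hexp : IsExpanding A) (hA : Polynomial.aeval α A = 0)
    (φ : K →+* ℂ) : 1 < ‖φ α‖ := by
  refine hexp _ ?_
  have := Polynomial.aeval_algHom_apply φ.toIntAlgHom α A
  rw [hA, map_zero] at this
  exact this

theorem mem_adjoin_iff_exists_aeval {x : K} :
    x ∈ Algebra.adjoin ℤ {α} ↔ ∃ p : Polynomial ℤ, Polynomial.aeval α p = x := by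
  rw [Algebra.adjoin_singleton_eq_range_aeval]
  rfl

theorem exists_intCast_add_mul {x : K} (hx : x ∈ Algebra.adjoin ℤ {α}) :
    ∃ n : ℤ, ∃ y ∈ Algebra.adjoin ℤ {α}, x = n + α * y := by
  obtain ⟨p, rfl⟩ := mem_adjoin_iff_exists_aeval.1 hx
  refine ⟨p.coeff 0, _, mem_adjoin_iff_exists_aeval.2 ⟨p.divX, rfl⟩, ?_⟩
  have h := congrArg (Polynomial.aeval α) p.divX_mul_X_add
  simp only [map_add, map_mul, Polynomial.aeval_X, Polynomial.aeval_C] at h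
  rw [eq_intCast] at h
  linear_combination -h

theorem IsExpanding.coeff_zero_ne_zero (hexp : IsExpanding A) : A.coeff 0 ≠ 0 := by
  intro h
  have := hexp 0 (by rw [← Polynomial.coeff_zero_eq_aeval_zero', h, map_zero])
  simp at this
  linarith

variable [NumberField K]

theorem IsExpanding.ne_zero (hexp : IsExpanding A) (hA : Polynomial.aeval α A = 0) : α ≠ 0 := by
  rintro rfl
  have := hexp.one_lt_norm_embedding hA (Classical.arbitrary (K →+* ℂ))
  simp at this
  linarith

theorem IsExpanding.ne_one (hexp : IsExpanding A) (hA : Polynomial.aeval α A = 0) : α ≠ 1 := by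
  rintro rfl
  have := hexp.one_lt_norm_embedding hA (Classical.arbitrary (K →+* ℂ))
  simp at this

/-- Over `ℚ`, `A` is associated to the minimal polynomial; Gauss's lemma brings the divisibility
back to `ℤ[X]`. -/
theorem IsPrimitiveMinpoly.dvd (hA : IsPrimitiveMinpoly A α) {p : Polynomial ℤ}
    (hp : Polynomial.aeval α p = 0) : A ∣ p := by
  obtain ⟨hprim, hirr, hα⟩ := hA
  refine (hprim.dvd_iff_fraction_map_dvd_fraction_map ℚ).2 ?_
  have h1 : Irreducible (A.map (algebraMap ℤ ℚ)) :=
    (hprim.irreducible_iff_irreducible_map_fraction_map (K := ℚ)).1 hirr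
  have h2 : ∀ q : Polynomial ℤ, Polynomial.aeval α q = 0 →
      minpoly ℚ α ∣ q.map (algebraMap ℤ ℚ) := fun q hq =>
    minpoly.dvd ℚ α (by rwa [Polynomial.aeval_map_algebraMap])
  have h3 : Irreducible (minpoly ℚ α) := minpoly.irreducible (Algebra.IsIntegral.isIntegral α)
  exact (h3.dvd_symm h1 (h2 A hα)).trans (h2 p hp)

/-- If `n = α g(α)`, then `A` divides `n - X g`; compare constant terms. Conversely, `A(α) = 0`
exhibits `a₀` as a multiple of `α` in `ℤ[α]`. -/
theorem IsPrimitiveMinpoly.intCast_mem_iff (hA : IsPrimitiveMinpoly A α) (n : ℤ) :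
    (∃ y ∈ Algebra.adjoin ℤ {α}, (n : K) = α * y) ↔ A.coeff 0 ∣ n := by
  constructor
  · rintro ⟨y, hy, hn⟩
    obtain ⟨g, rfl⟩ := mem_adjoin_iff_exists_aeval.1 hy
    obtain ⟨h, hh⟩ := hA.dvd (p := Polynomial.C n - Polynomial.X * g) (by simp [hn])
    have := congrArg (Polynomial.coeff · 0) hh
    simp only [Polynomial.coeff_sub, Polynomial.coeff_C_zero, Polynomial.mul_coeff_zero,
      Polynomial.coeff_X_zero, zero_mul, sub_zero] at this
    exact ⟨_, this⟩
  · rintro ⟨k, rfl⟩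
    refine ⟨-(k * Polynomial.aeval α A.divX), neg_mem (mul_mem (intCast_mem _ k)
      (mem_adjoin_iff_exists_aeval.2 ⟨_, rfl⟩)), ?_⟩
    have h := congrArg (Polynomial.aeval α) A.divX_mul_X_add
    simp only [map_add, map_mul, Polynomial.aeval_X, Polynomial.aeval_C, hA.2.2] at h
    rw [eq_intCast] at h
    push_cast
    linear_combination (k : K) * h

/-- A standard digit set has `|a₀|` elements. -/
theorem IsStandardDigitSet.finite_and_ncard (h𝒟 : IsStandardDigitSet α 𝒟)
    (hA : IsPrimitiveMinpoly A α) (hexp : IsExpanding A) :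
    𝒟.Finite ∧ (𝒟.ncard : ℤ) = |A.coeff 0| := by
  have ha : A.coeff 0 ≠ 0 := hexp.coeff_zero_ne_zero
  have hex : ∀ n : ℤ, ∃ d, d ∈ 𝒟 ∧ ∃ y ∈ Algebra.adjoin ℤ {α}, (n : K) - d = α * y := fun n =>
    (h𝒟.2 n (intCast_mem _ n)).exists
  choose dig hdig hy using hex
  have hcong : ∀ m n : ℤ, A.coeff 0 ∣ m - n ↔ dig m = dig n := by
    intro m n
    rw [← hA.intCast_mem_iff]
    obtain ⟨y, hyR, hym⟩ := hy m
    obtain ⟨z, hzR, hzn⟩ := hy n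
    constructor
    · rintro ⟨w, hw, hmn⟩
      refine (h𝒟.2 m (intCast_mem _ m)).unique ⟨hdig m, y, hyR, hym⟩
        ⟨hdig n, w + z, add_mem hw hzR, ?_⟩
      push_cast at hmn
      linear_combination hmn + hzn
    · intro h
      refine ⟨y - z, sub_mem hyR hzR, ?_⟩
      push_cast
      rw [h] at hym
      linear_combination hym - hzn
  -- Every class of `ℤ[α]/αℤ[α]` contains an integer, and two integers are congruent exactly when
  -- `a₀` divides their difference.
  have himg : dig '' (Finset.Ico (0 : ℤ) |A.coeff 0| : Set ℤ) = 𝒟 := by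
    refine Set.Subset.antisymm (by rintro _ ⟨n, -, rfl⟩; exact hdig n) fun d hd => ?_
    obtain ⟨n, y, hyR, hdn⟩ := exists_intCast_add_mul (h𝒟.1 d hd)
    refine ⟨n % A.coeff 0, ?_, ?_⟩
    · rw [Finset.coe_Ico]
      exact ⟨Int.emod_nonneg _ ha, Int.emod_lt_abs _ ha⟩
    · rw [(hcong _ n).1 ⟨-(n / A.coeff 0), by rw [Int.emod_def]; ring⟩]
      exact (h𝒟.2 n (intCast_mem _ n)).unique ⟨hdig n, hy n⟩
        ⟨hd, -y, neg_mem hyR, by linear_combination -hdn⟩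
  have hinj : Set.InjOn dig (Finset.Ico (0 : ℤ) |A.coeff 0| : Set ℤ) := by
    intro m hm n hn h
    rw [Finset.coe_Ico] at hm hn
    have h1 := (hcong m n).2 h
    have h2 : |m - n| < |A.coeff 0| := by
      rw [abs_lt]; constructor <;> linarith [hm.1, hm.2, hn.1, hn.2]
    exact sub_eq_zero.1 (Int.eq_zero_of_abs_lt_dvd ((abs_dvd _ _).2 h1) h2)
  refine ⟨himg ▸ (Finset.finite_toSet _).image _, ?_⟩
  rw [← himg, hinj.ncard_image, Set.ncard_coe_finset, Int.card_Ico]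
  simp

end DigitSets

/-! ### Real-valued and non-constant combinations of the characters. -/

section Characters

variable {K : Type*} [Field K] [NumberField K]

theorem charInfinite_neg (z : mixedSpace K) :
    charInfinite (-z) = (starRingEnd ℂ) (charInfinite z) := by
  simp only [charInfinite, map_mul, map_prod, ← Complex.exp_conj]
  simp [Complex.conj_ofNat]

theorem padic_valuation_neg {p : ℕ} [Fact p.Prime] (x : ℚ_[p]) :
    (-x).valuation = x.valuation := by
  rcases eq_or_ne x 0 with rfl | hx
  · simp
  have hp : (1 : ℝ) < p := by exact_mod_cast (Fact.out : p.Prime).one_lt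
  have h := norm_neg x
  rw [Padic.norm_eq_zpow_neg_valuation hx, Padic.norm_eq_zpow_neg_valuation (neg_ne_zero.2 hx)] at h
  exact neg_injective (zpow_right_injective₀ (one_pos.trans hp) hp.ne' h)

/-- The representatives of `p^k x` and `-p^k x` modulo `p^k` add up to a multiple of `p^k`. Hence
the local character turns negation into complex conjugation. -/
theorem padicFract_neg_add {p : ℕ} [Fact p.Prime] (x : ℚ_[p]) :
    ∃ n : ℤ, padicFract (-x) + padicFract x = n := by
  have hp0 : (p : ℚ) ≠ 0 := by exact_mod_cast (Fact.out : p.Prime).ne_zero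
  set k := (-x.valuation).toNat with hk
  have hk' : (-(-x).valuation).toNat = k := by rw [padic_valuation_neg]
  let y : ℤ_[p] := ⟨(p : ℚ_[p]) ^ k * x, padic_shift_norm_le x⟩
  have h1 : padicFract x = (y.appr k : ℚ) / (p : ℚ) ^ k := rfl
  have h2 : padicFract (-x) = ((-y).appr k : ℚ) / (p : ℚ) ^ k := by
    -- The exponent is made a variable because the integrality proof inside the term depends on it.
    have h3 : ∀ (j : ℕ) (hj : ‖(p : ℚ_[p]) ^ j * -x‖ ≤ 1), j = k →
        (PadicInt.appr ⟨(p : ℚ_[p]) ^ j * -x, hj⟩ j : ℚ) / (p : ℚ) ^ j =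
          ((-y).appr k : ℚ) / (p : ℚ) ^ k := by
      rintro j hj rfl
      congr 3
      exact Subtype.ext (mul_neg _ _)
    exact h3 _ (padic_shift_norm_le (-x)) hk'
  have h3 : ((-y).appr k + y.appr k : ℤ_[p]) ∈ Ideal.span {(p : ℤ_[p]) ^ k} := by
    have h4 := add_mem (PadicInt.appr_spec k y) (PadicInt.appr_spec k (-y))
    rw [← neg_mem_iff] at h4
    convert h4 using 1
    ring
  have h4 : (p : ℤ) ^ k ∣ ((-y).appr k + y.appr k : ℕ) := by
    rw [← PadicInt.pow_p_dvd_int_iff, ← Ideal.mem_span_singleton]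
    exact_mod_cast h3
  obtain ⟨n, hn⟩ := h4
  refine ⟨n, ?_⟩
  rw [h1, h2, ← add_div, div_eq_iff (pow_ne_zero _ hp0)]
  have : (((((-y).appr k + y.appr k : ℕ) : ℤ)) : ℚ) = (((p : ℤ) ^ k * n : ℤ) : ℚ) := by rw [hn]
  push_cast at this
  rw [this, mul_comm]

theorem localTrace_neg (v : HeightOneSpectrum (𝓞 K)) (z : v.adicCompletion K) :
    localTrace v (-z) = -localTrace v z := by
  let := (padicToCompletion v).toAlgebra
  exact map_neg (Algebra.trace ℚ_[primeBelow v] (v.adicCompletion K)) z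

theorem charFinite_neg (v : HeightOneSpectrum (𝓞 K)) (z : v.adicCompletion K) :
    charFinite v (-z) = (starRingEnd ℂ) (charFinite v z) := by
  obtain ⟨n, hn⟩ := padicFract_neg_add (localTrace v z)
  rw [charFinite, charFinite, localTrace_neg, ← Complex.exp_conj, eq_sub_of_add_eq hn,
    Complex.exp_eq_exp_iff_exists_int]
  refine ⟨n, ?_⟩
  simp [Complex.conj_ofNat]
  ring

theorem charRep_neg (α : K) (z : RepSpace α) :
    charRep α (-z) = (starRingEnd ℂ) (charRep α z) := by
  rw [charRep, charRep, map_mul, map_prod, Prod.fst_neg, charInfinite_neg]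
  simp only [Prod.snd_neg, Pi.neg_apply, charFinite_neg]

theorem charTwist_neg (α ξ : K) (z : RepSpace α) :
    charTwist α (-ξ) z = (starRingEnd ℂ) (charTwist α ξ z) := by
  rw [charTwist, map_neg, neg_mul, charRep_neg, charTwist]

/-- Conjugation exchanges the terms for `x` and `-x`, which carry the same coefficient. -/
theorem im_fourierInv_eq_zero (α : K) (V : Set K) [Fintype V] (σ : Equiv.Perm V)
    (hσ : ∀ x, (σ x : K) = -x) {s : V → ℝ} (hs : ∀ x, s (σ x) = s x) (z : RepSpace α) :
    (fourierInv α V s z).im = 0 := by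
  rw [← Complex.conj_eq_iff_im]
  change (starRingEnd ℂ) (∑ x : V, (s x : ℂ) * charTwist α x z) = ∑ x : V, (s x : ℂ) * charTwist α x z
  rw [map_sum, ← Equiv.sum_comp σ]
  refine Finset.sum_congr rfl fun x _ => ?_
  rw [map_mul, Complex.conj_ofReal, ← charTwist_neg, hσ, neg_neg, hs]

theorem not_const_fourierInv (α : K) (V : Set K) [Fintype V] (hV : (0 : K) ∉ V) {s : V → ℝ}
    (hs : s ≠ 0) : ¬ ∃ c : ℂ, ∀ z, fourierInv α V s z = c := by
  rintro ⟨c, hc⟩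
  -- The extra index `none` carries the trivial character, which belongs to `0 ∉ V` and accounts for
  -- the constant `c`.
  have hli := (linearIndependent_monoidHom (Multiplicative (mixedSpace K)) ℂ).comp
    (fun x : Option V => (charInfiniteHom (x.elim 0 (fun x => (x : K)))))
    (charInfiniteHom_injective.comp (by
      rintro (_ | x) (_ | y) h
      · rfl
      · exact absurd ((show (0 : K) = y from h) ▸ y.2) hV
      · exact absurd ((show (x : K) = 0 from h) ▸ x.2) hV
      · exact congrArg some (Subtype.ext h)))
  rw [Fintype.linearIndependent_iff] at hli
  refine hs (funext fun x => ?_)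
  have := hli (fun x => x.elim (-c) (fun x => (s x : ℂ))) (by
    funext z
    have h := hc (z.toAdd, 0)
    simp only [fourierInv, LinearMap.coe_mk, AddHom.coe_mk, charTwist_infinite] at h
    rw [Fintype.sum_option]
    have h0 : charInfiniteHom (0 : K) z = 1 := by simp [charInfiniteHom, charInfinite_zero]
    simp [h0, ← h]) (some x)
  exact Complex.ofReal_eq_zero.1 this

end Characters

/-! ### The digit module and symmetries of the contact matrix. -/

section DigitModule

variable {K : Type*} [Field K] {α : K} {𝒟 : Set K}

theorem sub_mem_digitModule {d d' : K} (hd : d ∈ 𝒟) (hd' : d' ∈ 𝒟) : d - d' ∈ digitModule α 𝒟 :=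
  Submodule.mem_sInf.2 fun _ hM => hM.1 d hd d' hd'

theorem mul_mem_digitModule {x : K} (hx : x ∈ digitModule α 𝒟) : α * x ∈ digitModule α 𝒟 :=
  Submodule.mem_sInf.2 fun M hM => hM.2 x (Submodule.mem_sInf.1 hx M hM)

theorem IsStandardDigitSet.digitModule_le (h : IsStandardDigitSet α 𝒟) {x : K}
    (hx : x ∈ digitModule α 𝒟) : x ∈ Algebra.adjoin ℤ {α} :=
  Submodule.mem_sInf.1 hx (Subalgebra.toSubmodule (Algebra.adjoin ℤ {α}))
    ⟨fun d hd d' hd' => sub_mem (h.1 d hd) (h.1 d' hd'),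
      fun _ hx => (Algebra.adjoin ℤ {α}).mul_mem (Algebra.subset_adjoin rfl) hx⟩

theorem IsStandardDigitSet.eq_of_sub_eq_mul (h : IsStandardDigitSet α 𝒟) {d d' y : K} (hd : d ∈ 𝒟)
    (hd' : d' ∈ 𝒟) (hy : y ∈ Algebra.adjoin ℤ {α}) (heq : d - d' = α * y) : d = d' :=
  (h.2 d (h.1 d hd)).unique ⟨hd, 0, zero_mem _, by simp⟩ ⟨hd', y, hy, heq⟩

theorem mul_mem_of_mem_adjoin {H : AddSubgroup K} (hH : ∀ x ∈ H, α * x ∈ H) {a x : K} (ha : a ∈ H)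
    (hx : x ∈ Algebra.adjoin ℤ {α}) : x * a ∈ H := by
  obtain ⟨p, rfl⟩ := mem_adjoin_iff_exists_aeval.1 hx
  have hpow : ∀ k : ℕ, α ^ k * a ∈ H := by
    intro k
    induction k with
    | zero => simpa using ha
    | succ k ih => rw [pow_succ', mul_assoc]; exact hH _ ih
  rw [Polynomial.aeval_eq_sum_range, Finset.sum_mul]
  refine sum_mem fun k _ => ?_
  rw [smul_mul_assoc]
  exact H.zsmul_mem (hpow k) _

section
open scoped Classical

/-- Translation by `-αx - y` carries `(αx + 𝒟) ∩ (y + 𝒟)` onto `(-αx + 𝒟) ∩ (-y + 𝒟)`, exchanging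
the roles of the two sets. -/
theorem contactMatrix_neg {V : Set K} {x y x' y' : V} (hx : (x' : K) = -x) (hy : (y' : K) = -y) :
    contactMatrix α 𝒟 V x' y' = contactMatrix α 𝒟 V x y := by
  simp only [contactMatrix, Matrix.of_apply, hx, hy, Nat.cast_inj]
  rw [← Set.ncard_image_of_injective
    (((fun d => α * (x : K) + d) '' 𝒟) ∩ ((fun d => (y : K) + d) '' 𝒟))
    (add_left_injective (-(α * (x : K)) - y))]
  congr 1
  ext s
  constructor
  · rintro ⟨⟨d, hd, rfl⟩, d', hd', h⟩
    exact ⟨y + d, ⟨⟨d', hd', by linear_combination h⟩, d, hd, rfl⟩, by ring⟩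
  · rintro ⟨_, ⟨⟨d, hd, rfl⟩, d', hd', h⟩, rfl⟩
    simp only at h
    exact ⟨⟨d', hd', by simp only; linear_combination h⟩, d, hd, by ring⟩

theorem contactMatrix_eq_contactCount {V : Set K} {d₀ : K} {E : Finset K}
    (hE : (E : Set K) = (fun d => d - d₀) '' 𝒟) (x y : V) :
    contactMatrix α 𝒟 V x y = contactCount (AddMonoidHom.mulLeft α) E (x : K) y := by
  rw [contactMatrix, Matrix.of_apply, contactCount, Nat.cast_inj, ← Set.ncard_coe_finset,
    ← Set.ncard_image_of_injective _ (sub_left_injective (b := d₀)),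
    Set.image_inter sub_left_injective]
  push_cast
  rw [hE]
  simp only [Set.image_image, add_sub_assoc]

end

theorem subset_contactSet [NumberField K] {D : Set (RepSpace α)} (k : ℕ) :
    contactStep α 𝒟 D k ⊆ contactSet α 𝒟 D := Set.subset_iUnion (contactStep α 𝒟 D) k

end DigitModule

/-! ### The lattice `Φ_α(I)`, its generation by neighbours, and the contact set. -/

section LatticeOfDigitModule

open scoped Classical

variable {K : Type*} [Field K] [NumberField K] {α : K} {𝒟 : Set K}

theorem translate_eq_vadd (D : Set (RepSpace α)) (x : K) : translate α D x = diag α x +ᵥ D := by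
  rw [translate, ← Set.image_vadd]
  simp only [vadd_eq_add, add_comm]

/-- The image `Φ_α(I)` of an additive subgroup `I` of `K`. -/
noncomputable def diagMap (α : K) (I : AddSubgroup K) : AddSubgroup (RepSpace α) :=
  I.map (diag α : K →+ RepSpace α)

theorem diag_mem_diagMap {I : AddSubgroup K} {x : K} (hx : x ∈ I) : diag α x ∈ diagMap α I :=
  ⟨x, hx, rfl⟩

theorem coe_diagMap (I : AddSubgroup K) : (diagMap α I : Set (RepSpace α)) = diag α '' I := rfl

theorem isBoundedlyFinite_diagMap {I : AddSubgroup K} (hI : ∀ x ∈ I, x ∈ Algebra.adjoin ℤ {α}) :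
    IsBoundedlyFinite (diagMap α I : Set (RepSpace α)) :=
  (isBoundedlyFinite_diag_adjoin α).mono (Set.image_mono hI)

theorem isTiling_translates_iff {D : Set (RepSpace α)} (hD : IsCompact D) :
    IsTiling (repMeasure α) (translates α 𝒟 D) ↔
      AlmostPartition (repMeasure α) (diagMap α (digitModule α 𝒟).toAddSubgroup) D := by
  have h : translates α 𝒟 D = (fun x => x +ᵥ D) ''
      (diagMap α (digitModule α 𝒟).toAddSubgroup : Set (RepSpace α)) := by
    rw [coe_diagMap, Set.image_image, translates]
    simp only [translate_eq_vadd]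
    rfl
  rw [IsTiling, IsMultipleTiling, AlmostPartition, h]
  constructor
  · exact fun h => h.2.2
  · refine fun h => ⟨one_pos, ?_, h⟩
    rintro _ ⟨x, -, rfl⟩
    exact hD.vadd x

theorem nsmul_diagMap_eq_zero {I : AddSubgroup K} :
    ∀ x ∈ diagMap α I, x ≠ 0 → ∀ n : ℕ, n • x = 0 → n = 0 := by
  rintro _ ⟨x, -, rfl⟩ hx0 n hn
  have h1 : diag α (n • x) = diag α 0 := by
    rw [map_nsmul, map_zero]; exact hn
  rcases smul_eq_zero.1 (diag_injective α h1) with h2 | h2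
  · exact h2
  · exact absurd (by rw [h2]; exact map_zero (diag α)) hx0

/-- Multiply the covering by `Φ_α(a)`: since `H` is a `ℤ[α]`-module, it contains `I a`. Thus any
nonzero `α`-invariant subgroup is cocompact. -/
theorem diagMap_add_image_eq_univ {I H : AddSubgroup K} (hI : ∀ x ∈ I, x ∈ Algebra.adjoin ℤ {α})
    (hH : ∀ x ∈ H, α * x ∈ H) {a : K} (haH : a ∈ H) (ha0 : a ≠ 0) {D : Set (RepSpace α)}
    (hcov : (diagMap α I : Set (RepSpace α)) + D = Set.univ) :
    (diagMap α H : Set (RepSpace α)) + mulDiag α a '' D = Set.univ := by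
  refine Set.eq_univ_of_forall fun z => ?_
  obtain ⟨w, rfl⟩ := (bijective_mulDiag α ha0).2 z
  obtain ⟨_, ⟨x, hx, rfl⟩, δ, hδ, rfl⟩ := Set.mem_add.1 (Set.eq_univ_iff_forall.1 hcov w)
  refine Set.mem_add.2 ⟨diag α (x * a), diag_mem_diagMap
    (mul_mem_of_mem_adjoin hH haH (hI x hx)), _, ⟨δ, hδ, rfl⟩, ?_⟩
  rw [map_add, mul_comm x a, ← mulDiag_diag]
  rfl

/-- If `H` contains the neighbours of the tile `D` and is closed under multiplication by `α`, it is
the whole lattice. -/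
theorem le_of_neighbors_mem {I H : AddSubgroup K} (hI : ∀ x ∈ I, x ∈ Algebra.adjoin ℤ {α})
    (hHI : H ≤ I) (hH : ∀ x ∈ H, α * x ∈ H) {D : Set (RepSpace α)} (hD : IsCompact D)
    (hcov : (diagMap α I : Set (RepSpace α)) + D = Set.univ)
    (hnb : ∀ x ∈ I, (D ∩ (diag α x +ᵥ D)).Nonempty → x ∈ H) : I ≤ H := by
  have hbf := isBoundedlyFinite_diagMap hI
  have hD0 : D.Nonempty := by
    obtain ⟨x, -, δ, hδ, -⟩ := Set.mem_add.1 (hcov.symm ▸ Set.mem_univ (0 : RepSpace α))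
    exact ⟨δ, hδ⟩
  set U : Set (RepSpace α) := (diag α '' (H : Set K)) + D with hU
  set U' : Set (RepSpace α) := (diag α '' ((I : Set K) \ H)) + D with hU'
  -- If the tiles at `h ∈ H` and `x ∉ H` met, then `x - h` would be a neighbour and so lie in `H`.
  have hdisj : Disjoint U U' := by
    refine Set.disjoint_left.2 fun z hz hz' => ?_
    obtain ⟨_, ⟨h, hh, rfl⟩, δ, hδ, rfl⟩ := Set.mem_add.1 hz
    obtain ⟨_, ⟨x, ⟨hx, hxH⟩, rfl⟩, δ', hδ', heq⟩ := Set.mem_add.1 hz'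
    refine hxH ?_
    have h1 : x - h ∈ H := hnb _ (I.sub_mem hx (hHI hh)) ⟨δ, hδ, δ', hδ', by
      change diag α (x - h) + δ' = δ
      rw [map_sub, sub_add_eq_add_sub, heq, add_sub_cancel_left]⟩
    simpa using H.add_mem h1 hh
  have hunion : U ∪ U' = Set.univ := by
    refine Set.eq_univ_of_forall fun z => ?_
    obtain ⟨_, ⟨x, hx, rfl⟩, δ, hδ, rfl⟩ := Set.mem_add.1 (hcov.symm ▸ Set.mem_univ z)
    by_cases hxH : x ∈ H
    · exact Or.inl (Set.add_mem_add ⟨x, hxH, rfl⟩ hδ)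
    · exact Or.inr (Set.add_mem_add ⟨x, ⟨hx, hxH⟩, rfl⟩ hδ)
  have hUc : IsClosed U := (hbf.mono (Set.image_mono hHI)).isClosed_add hD
  have hU'c : IsClosed U' := (hbf.mono (Set.image_mono Set.sdiff_subset)).isClosed_add hD
  have hUeq : U = U'ᶜ := Set.Subset.antisymm hdisj.subset_compl_right fun z hz =>
    ((Set.eq_univ_iff_forall.1 hunion z).resolve_right hz)
  have hclopen : IsClopen U := ⟨hUc, by rw [hUeq]; exact hU'c.isOpen_compl⟩
  obtain ⟨δ, hδ⟩ := hD0
  have hδU : δ ∈ U := Set.mem_add.2 ⟨0, ⟨0, H.zero_mem, map_zero _⟩, δ, hδ, zero_add _⟩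
  have huniv : U = Set.univ := by
    by_cases hbot : H = ⊥
    -- For `H = 0` the clopen set is `D` itself, which would contain an unbounded copy of `𝕂_∞`.
    · exfalso
      have hUD : U = D := by rw [hU, hbot]; simp
      obtain ⟨M, hM⟩ := hD.isBounded.exists_norm_le
      obtain ⟨a, ha⟩ := NormedSpace.exists_lt_norm ℝ (mixedSpace K) M
      have h1 : ((a, δ.2) : RepSpace α) ∈ U := mem_of_isClopen_of_snd_eq hclopen hδU rfl
      rw [hUD] at h1
      exact absurd ((norm_fst_le _).trans (hM _ h1)) (not_le.2 ha)
    · obtain ⟨a, haH, ha0⟩ := H.bot_or_exists_ne_zero.resolve_left hbot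
      refine eq_univ_of_isClopen_of_cocompact α hclopen ⟨δ, hδU⟩ (H := diagMap α H) ?_
        (hD.image (continuous_mulDiag α a)) ?_
      · rintro _ ⟨h, hh, rfl⟩ u hu
        obtain ⟨_, ⟨h', hh', rfl⟩, δ', hδ', rfl⟩ := Set.mem_add.1 hu
        refine Set.mem_add.2 ⟨_, ⟨h + h', H.add_mem hh hh', rfl⟩, δ', hδ', ?_⟩
        rw [map_add, add_assoc]
        rfl
      · exact diagMap_add_image_eq_univ hI hH haH ha0 hcov
  intro x hx
  by_contra hxH
  have h1 : diag α x + δ ∈ U' := Set.add_mem_add ⟨x, ⟨hx, hxH⟩, rfl⟩ hδ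
  exact Set.disjoint_left.1 hdisj (huniv ▸ Set.mem_univ _) h1

/-- All `𝒱_k` lie in one ball: from `αx = y + d' - d` and expansion, `ρ‖x‖ ≤ ‖y‖ + 2c`. The radius
`B` bounds the neighbours of `D` and satisfies `B + 2c ≤ ρB`, so the bound propagates. -/
theorem finite_contactSet {D : Set (RepSpace α)} (hD : IsCompact D)
    (hα : ∀ φ : K →+* ℂ, 1 < ‖φ α‖) (h𝒟 : IsStandardDigitSet α 𝒟) (hfin : 𝒟.Finite) :
    (contactSet α 𝒟 D).Finite := by
  obtain ⟨ρ, hρ, hexp⟩ := exists_expansion α hα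
  obtain ⟨M, hM⟩ := hD.isBounded.exists_norm_le
  obtain ⟨c, hc⟩ := (hfin.image (diag α)).isBounded.exists_norm_le
  set B := max (M + M) (2 * c / (ρ - 1)) with hB
  have hcB : 2 * c ≤ (ρ - 1) * B := by
    rw [mul_comm (ρ - 1), ← div_le_iff₀ (by linarith)]
    exact le_max_right _ _
  have hstep : ∀ k, ∀ x ∈ contactStep α 𝒟 D k, x ∈ digitModule α 𝒟 ∧ ‖diag α x‖ ≤ B := by
    intro k
    induction k with
    | zero =>
      rintro x ⟨hx, -, δ, hδ, δ', hδ', h⟩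
      refine ⟨hx, le_trans ?_ (le_max_left _ _)⟩
      have h1 : diag α x = δ - δ' := eq_sub_of_add_eq' h
      rw [h1]
      exact (norm_sub_le _ _).trans (add_le_add (hM _ hδ) (hM _ hδ'))
    | succ k ih =>
      rintro x ⟨hx, -, y, hy, _, ⟨d, hd, rfl⟩, d', hd', h⟩
      refine ⟨hx, ?_⟩
      have h1 : mulDiag α α (diag α x) = diag α y + (diag α d' - diag α d) := by
        rw [mulDiag_diag, ← map_sub, ← map_add]
        congr 1
        linear_combination -h
      have h2 := hexp (diag α x)
      rw [h1] at h2
      have h3 := norm_add_le (diag α y) (diag α d' - diag α d)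
      have h4 := norm_sub_le (diag α d') (diag α d)
      have h5 := hc _ ⟨d, hd, rfl⟩
      have h6 := hc _ ⟨d', hd', rfl⟩
      have h7 := (ih y hy).2
      have h8 : ρ * ‖diag α x‖ ≤ ρ * B := by linarith
      exact le_of_mul_le_mul_left h8 (by linarith)
  have hsub : diag α '' contactSet α 𝒟 D ⊆
      {z ∈ diag α '' (Algebra.adjoin ℤ {α} : Set K) | ‖z‖ ≤ B} := by
    rintro _ ⟨x, hx, rfl⟩
    obtain ⟨k, hk⟩ := Set.mem_iUnion.1 hx
    exact ⟨⟨x, h𝒟.digitModule_le (hstep k x hk).1, rfl⟩, (hstep k x hk).2⟩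
  exact ((isBoundedlyFinite_diag_adjoin α B).subset hsub).of_finite_image
    (diag_injective α).injOn

theorem mem_digitModule_of_mem_contactSet {D : Set (RepSpace α)} {x : K}
    (hx : x ∈ contactSet α 𝒟 D) : x ∈ digitModule α 𝒟 ∧ x ≠ 0 := by
  obtain ⟨k, hk⟩ := Set.mem_iUnion.1 hx
  cases k with
  | zero => exact ⟨hk.1, hk.2.1⟩
  | succ k => exact ⟨hk.1, hk.2.1⟩

theorem mem_contactSet_of_mul_add_eq {D : Set (RepSpace α)} {x y d d' : K}
    (hy : y ∈ contactSet α 𝒟 D) (hx : x ∈ digitModule α 𝒟) (hx0 : x ≠ 0) (hd : d ∈ 𝒟) (hd' : d' ∈ 𝒟)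
    (h : α * x + d = y + d') : x ∈ contactSet α 𝒟 D := by
  obtain ⟨k, hk⟩ := Set.mem_iUnion.1 hy
  exact subset_contactSet (k + 1) ⟨hx, hx0, y, hk, _, ⟨d, hd, rfl⟩, d', hd', h.symm⟩

theorem neg_mem_contactSet {D : Set (RepSpace α)} {x : K} (hx : x ∈ contactSet α 𝒟 D) :
    -x ∈ contactSet α 𝒟 D := by
  have h : ∀ k, ∀ x ∈ contactStep α 𝒟 D k, -x ∈ contactStep α 𝒟 D k := by
    intro k
    induction k with
    | zero =>
      rintro x ⟨hx, hx0, δ, hδ, δ', hδ', h⟩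
      refine ⟨neg_mem hx, neg_ne_zero.2 hx0, δ', hδ', δ, hδ, ?_⟩
      change δ' + diag α x = δ at h
      change δ + diag α (-x) = δ'
      rw [← h, map_neg, add_neg_cancel_right]
    | succ k ih =>
      rintro x ⟨hx, hx0, y, hy, _, ⟨d, hd, rfl⟩, d', hd', h⟩
      refine ⟨neg_mem hx, neg_ne_zero.2 hx0, -y, ih y hy, _, ⟨d', hd', rfl⟩, d, hd, ?_⟩
      linear_combination -h
  obtain ⟨k, hk⟩ := Set.mem_iUnion.1 hx
  exact subset_contactSet k (h k x hk)

end LatticeOfDigitModule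

/-! ### From the contact matrix to the tiling property. -/

section TilingCriterion

open scoped Classical

variable {K : Type*} [Field K] [NumberField K] {α : K} {𝒟 : Set K}

theorem measure_ne_top_and_ne_zero {I : AddSubgroup K} (hI : ∀ x ∈ I, x ∈ Algebra.adjoin ℤ {α})
    {S : Set (RepSpace α)} (hS : IsCompact S)
    (hcov : (diagMap α I : Set (RepSpace α)) + S = Set.univ) :
    repMeasure α S ≠ ⊤ ∧ repMeasure α S ≠ 0 :=
  ⟨hS.measure_lt_top.ne,
    measure_ne_zero_of_add_eq_univ (isBoundedlyFinite_diagMap hI).countable hcov⟩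

/-- Digits `d - d₀` instead of `d` amount to a translate of the tile. -/
theorem IsSelfAffineTile.image_vadd {F : Set (RepSpace α)} (hF : IsSelfAffineTile α 𝒟 F) {d₀ : K}
    {E : Finset K} (hE : (E : Set K) = (fun d => d - d₀) '' 𝒟) (hα1 : α ≠ 1) :
    mulDiag α α '' (diag α (-(d₀ / (α - 1))) +ᵥ F) =
      ⋃ e ∈ E.image (diag α), (e +ᵥ (diag α (-(d₀ / (α - 1))) +ᵥ F)) := by
  -- The solution of `αγ = γ + d₀`: moving `F` by `-γ` absorbs the subtraction of `d₀` from the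
  -- digits.
  set γ := d₀ / (α - 1) with hγ
  have hαγ : α * γ = γ + d₀ := by
    have : α - 1 ≠ 0 := sub_ne_zero.2 hα1
    rw [hγ]; field_simp; ring
  have h1 : mulDiag α α '' (diag α (-γ) +ᵥ F) = diag α (-γ - d₀) +ᵥ mulDiag α α '' F := by
    rw [← Set.image_vadd, ← Set.image_vadd, Set.image_image, Set.image_image]
    refine Set.image_congr fun z _ => ?_
    rw [vadd_eq_add, vadd_eq_add, map_add, mulDiag_diag]
    congr 2
    linear_combination -hαγ
  have h2 : mulDiag α α '' F = ⋃ d ∈ 𝒟, (diag α d +ᵥ F) := by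
    have h3 := hF.2.2
    simp only [translate_eq_vadd] at h3
    exact h3
  rw [h1, h2, Set.vadd_set_iUnion₂]
  ext z
  simp only [Set.mem_iUnion, vadd_vadd, ← map_add, exists_prop]
  constructor
  · rintro ⟨d, hd, hz⟩
    refine ⟨diag α (d - d₀), Finset.mem_image_of_mem _ (Finset.mem_coe.1 (hE ▸ ⟨d, hd, rfl⟩)), ?_⟩
    rw [← map_add]
    convert hz using 3
    ring
  · rintro ⟨_, he, hz⟩
    obtain ⟨e, heE, rfl⟩ := Finset.mem_image.1 he
    obtain ⟨d, hd, rfl⟩ : e ∈ (fun d => d - d₀) '' 𝒟 := hE ▸ Finset.mem_coe.2 heE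
    refine ⟨d, hd, ?_⟩
    rw [← map_add] at hz
    convert hz using 3
    ring

theorem add_vadd_eq_univ {I : AddSubgroup K} {S : Set (RepSpace α)} {w : RepSpace α} :
    (diagMap α I : Set (RepSpace α)) + (w +ᵥ S) = Set.univ ↔
      (diagMap α I : Set (RepSpace α)) + S = Set.univ := by
  have h : (diagMap α I : Set (RepSpace α)) + (w +ᵥ S) =
      w +ᵥ ((diagMap α I : Set (RepSpace α)) + S) := by
    rw [← Set.singleton_vadd, ← Set.singleton_vadd]
    simp only [vadd_eq_add, add_left_comm]
  rw [h]
  exact Set.vadd_set_eq_univ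

/-- Elements of `I` that are incongruent modulo `α I` number at most the factor by which
multiplication by `α` scales the measure. -/
theorem card_le_of_incongruent {I : AddSubgroup K} (hI : ∀ x ∈ I, x ∈ Algebra.adjoin ℤ {α})
    (hα0 : α ≠ 0) (hαI : ∀ x ∈ I, α * x ∈ I) {D : Set (RepSpace α)}
    (hD : IsLatticeTile (repMeasure α) (diagMap α I) D) {m : NNReal}
    (hm : ∀ S : Set (RepSpace α), IsCompact S →
      repMeasure α (mulDiag α α '' S) = m * repMeasure α S) {S : Finset K} (hS : ∀ s ∈ S, s ∈ I)
    (hinc : ∀ s ∈ S, ∀ s' ∈ S, ∀ x ∈ I, s = s' + α * x → s = s') : (S.card : NNReal) ≤ m := by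
  obtain ⟨hfin, hpos⟩ := measure_ne_top_and_ne_zero hI hD.isCompact hD.cover
  have h1 := hD.card_mul_measure_le (isBoundedlyFinite_diagMap hI) (T := mulDiag α α)
    (bijective_mulDiag α hα0) (continuous_mulDiag α α) (S := S.image (diag α)) (by
      rintro _ ⟨x, hx, rfl⟩
      exact ⟨α * x, hαI x hx, (mulDiag_diag α α x).symm⟩) (by
      intro s hs
      obtain ⟨t, ht, rfl⟩ := Finset.mem_image.1 hs
      exact diag_mem_diagMap (hS t ht)) (by
      intro s hs s' hs' x hx h
      obtain ⟨t, ht, rfl⟩ := Finset.mem_image.1 hs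
      obtain ⟨t', ht', rfl⟩ := Finset.mem_image.1 hs'
      obtain ⟨x, hxI, rfl⟩ := hx
      rw [show mulDiag α α ((diag α : K →+ RepSpace α) x) = diag α (α * x) from mulDiag_diag α α x,
        ← map_add] at h
      rw [hinc t ht t' ht' x hxI (diag_injective α h)])
  rw [hm D hD.isCompact, Finset.card_image_of_injective _ (diag_injective α)] at h1
  have h2 := (ENNReal.mul_le_mul_iff_left hpos hfin).1 h1
  exact_mod_cast h2

/-- The digits `d - d₀` form a digit system for `ℤ⟨α, 𝒟⟩`, and multiplication by `α` scales the
measure by the number of digits. -/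
theorem IsStandardDigitSet.isDigitSystem (h𝒟 : IsStandardDigitSet α 𝒟)
    (hα : ∀ φ : K →+* ℂ, 1 < ‖φ α‖) (hα0 : α ≠ 0) (hα1 : α ≠ 1) {D F : Set (RepSpace α)}
    (hF : IsSelfAffineTile α 𝒟 F)
    (hD : IsLatticeTile (repMeasure α) (diagMap α (digitModule α 𝒟).toAddSubgroup) D) {d₀ : K}
    (hd₀ : d₀ ∈ 𝒟) {E : Finset K} (hE : (E : Set K) = (fun d => d - d₀) '' 𝒟) :
    IsDigitSystem (AddMonoidHom.mulLeft α) E (digitModule α 𝒟).toAddSubgroup ∧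
      ∀ S : Set (RepSpace α), IsCompact S →
        repMeasure α (mulDiag α α '' S) = E.card * repMeasure α S := by
  set I := (digitModule α 𝒟).toAddSubgroup with hIdef
  have hI : ∀ x ∈ I, x ∈ Algebra.adjoin ℤ {α} := fun x hx => h𝒟.digitModule_le hx
  have hαI : ∀ x ∈ I, α * x ∈ I := fun x hx => mul_mem_digitModule hx
  have hEI : ∀ e ∈ E, e ∈ I := by
    intro e he
    obtain ⟨d, hd, rfl⟩ : e ∈ (fun d => d - d₀) '' 𝒟 := hE ▸ Finset.mem_coe.2 he
    exact sub_mem_digitModule hd hd₀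
  have hEinc : ∀ e ∈ E, ∀ e' ∈ E, ∀ x ∈ Algebra.adjoin ℤ {α}, e = e' + α * x → e = e' := by
    intro e he e' he' x hx h
    obtain ⟨d, hd, rfl⟩ : e ∈ (fun d => d - d₀) '' 𝒟 := hE ▸ Finset.mem_coe.2 he
    obtain ⟨d', hd', rfl⟩ : e' ∈ (fun d => d - d₀) '' 𝒟 := hE ▸ Finset.mem_coe.2 he'
    rw [h𝒟.eq_of_sub_eq_mul hd hd' hx (by linear_combination h)]
  obtain ⟨m, hm⟩ := exists_measure_image_mulDiag α hα0
  obtain ⟨ρ, hρ, hexp⟩ := exists_expansion α hα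
  set F' := diag α (-(d₀ / (α - 1))) +ᵥ F with hF'
  have hF'c : IsCompact F' := hF.2.1.vadd _
  have hTF' := hF.image_vadd hE hα1
  -- The digits are complete modulo `αℤ[α]` by assumption, so covering is available for `ℤ[α]`
  -- before it is for `I`. It serves only to give the tile positive measure.
  let R := (Subalgebra.toSubmodule (Algebra.adjoin ℤ {α})).toAddSubgroup
  have hR : ∀ x ∈ R, x ∈ Algebra.adjoin ℤ {α} := fun x hx => hx
  have hcovR : (diagMap α R : Set (RepSpace α)) + F' = Set.univ := by
    refine add_eq_univ_of_selfAffine hρ hexp (E := E.image (diag α)) (isBoundedlyFinite_diagMap hR)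
      ?_ hD.isCompact ?_ hF'c (hF.1.vadd_set) (by simpa only [Finset.mem_coe] using hTF')
    · rintro _ ⟨x, hx, rfl⟩
      obtain ⟨d, hd, y, hy, h⟩ := (h𝒟.2 (x + d₀) (add_mem hx (h𝒟.1 d₀ hd₀))).exists
      have hdE : d - d₀ ∈ E := Finset.mem_coe.1 (hE ▸ ⟨d, hd, rfl⟩)
      refine ⟨diag α (d - d₀), Finset.mem_coe.2 (Finset.mem_image_of_mem _ hdE), diag α y,
        diag_mem_diagMap hy, ?_⟩
      rw [mulDiag_diag, ← map_add]
      change diag α x = _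
      congr 1
      linear_combination h
    · refine Set.eq_univ_of_univ_subset (hD.cover ▸ Set.add_subset_add_right ?_)
      exact Set.image_mono hI
  obtain ⟨hfin, hpos⟩ := measure_ne_top_and_ne_zero hR hF'c hcovR
  -- Self-affinity of `F'` bounds the scaling factor above; packing by `D` bounds it below, as the
  -- digits are incongruent.
  have hmle : m ≤ E.card := by
    have h1 : repMeasure α (mulDiag α α '' F') ≤ E.card * repMeasure α F' := by
      rw [hTF']
      refine (measure_biUnion_finset_le _ _).trans ?_
      simp only [hF', measure_vadd, Finset.sum_const, nsmul_eq_mul,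
        Finset.card_image_of_injective _ (diag_injective α), le_refl]
    rw [hm F' hF'c] at h1
    have h2 := (ENNReal.mul_le_mul_iff_left hpos hfin).1 h1
    exact_mod_cast h2
  have hlem : (E.card : NNReal) ≤ m := card_le_of_incongruent hI hα0 hαI hD hm hEI
    fun s hs s' hs' x hx h => hEinc s hs s' hs' x (hI x hx) h
  refine ⟨⟨mul_right_injective₀ hα0, hαI, hEI, fun x hx => ?_,
    fun d hd d' hd' y hy y' hy' h => ?_⟩, fun S hS => ?_⟩
  -- An `x ∈ I` congruent to no digit modulo `αI` would give `#E + 1` incongruent elements, more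
  -- than the scaling factor allows.
  · by_contra! hno
    have hxE : x ∉ E := fun hxE => hno x hxE 0 I.zero_mem (by simp)
    have h1 : ((insert x E).card : NNReal) ≤ m := by
      refine card_le_of_incongruent hI hα0 hαI hD hm ?_ ?_
      · intro s hs
        rcases Finset.mem_insert.1 hs with rfl | hs
        exacts [hx, hEI s hs]
      · intro s hs s' hs' y hy h
        rcases Finset.mem_insert.1 hs with hsx | hsE <;>
          rcases Finset.mem_insert.1 hs' with hsx' | hsE'
        · rw [hsx, hsx']
        · exact absurd (hsx ▸ h) (hno s' hsE' y hy)
        · refine absurd ?_ (hno s hsE (-y) (I.neg_mem hy))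
          change _ = s + α * -y
          linear_combination -h - hsx'
        · exact hEinc s hsE s' hsE' y (hI y hy) h
    rw [Finset.card_insert_of_notMem hxE] at h1
    have h2 := h1.trans hmle
    norm_cast at h2
    omega
  · refine hEinc d hd d' hd' (y' - y) (hI _ (I.sub_mem hy' hy)) ?_
    change d + α * y = d' + α * y' at h
    linear_combination h
  · rw [hm S hS, le_antisymm hmle hlem]
    norm_cast

theorem digitSums_image_diag {E : Finset K} (n : ℕ) :
    digitSums (mulDiag α α) (E.image (diag α)) n =
      (digitSums (AddMonoidHom.mulLeft α) E n).image (diag α) := by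
  induction n with
  | zero => simp [digitSums_zero]
  | succ n ih =>
    rw [digitSums, digitSums, ih, Finset.image₂_image_left, Finset.image₂_image_right,
      Finset.image_image₂]
    congr 1
    funext d e
    rw [mulDiag_diag, ← map_add]
    rfl

/-- If almost all digit sums stay digit sums under translation by every element of the lattice, the
self-affine tile gives a tiling. -/
theorem IsDigitSystem.isLatticeTile {I : AddSubgroup K} {E : Finset K}
    (h : IsDigitSystem (AddMonoidHom.mulLeft α) E I) (hI : ∀ x ∈ I, x ∈ Algebra.adjoin ℤ {α})
    (hα : ∀ φ : K →+* ℂ, 1 < ‖φ α‖)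
    (hm : ∀ S : Set (RepSpace α), IsCompact S →
        repMeasure α (mulDiag α α '' S) = E.card * repMeasure α S)
    {D : Set (RepSpace α)} (hD : IsLatticeTile (repMeasure α) (diagMap α I) D)
    {F : Set (RepSpace α)} (hF0 : F.Nonempty) (hF : IsCompact F)
    (hTF : mulDiag α α '' F = ⋃ e ∈ E.image (diag α), (e +ᵥ F))
    (hstab : I ≤ almostStabilizer (AddMonoidHom.mulLeft α) E I) :
    IsLatticeTile (repMeasure α) (diagMap α I) F := by
  obtain ⟨ρ, hρ, hexp⟩ := exists_expansion α hα
  refine ⟨hF, ?_, ?_⟩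
  · refine add_eq_univ_of_selfAffine hρ hexp (E := E.image (diag α)) (isBoundedlyFinite_diagMap hI)
      ?_ hD.isCompact hD.cover hF hF0 (by simpa only [Finset.mem_coe] using hTF)
    rintro _ ⟨x, hx, rfl⟩
    obtain ⟨d, hd, y, hy, rfl⟩ := h.exists_digit x hx
    refine ⟨diag α d, Finset.mem_coe.2 (Finset.mem_image_of_mem _ hd), diag α y,
      diag_mem_diagMap hy, ?_⟩
    rw [mulDiag_diag, ← map_add]
    rfl
  · rintro _ ⟨y, hy, rfl⟩ hy0
    have hy0' : y ≠ 0 := fun h0 => hy0 (by rw [h0]; exact map_zero (diag α))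
    obtain ⟨n, e, he, hey⟩ := h.exists_add_mem_digitSums (hstab hy)
    have hiter : IsCompact ((mulDiag α α)^[n] '' F) ∧
        repMeasure α ((mulDiag α α)^[n] '' F) = E.card ^ n * repMeasure α F := by
      -- The induction must not carry the choice of `e`, which depends on `n`.
      clear he hey
      induction n with
      | zero => simpa using hF
      | succ n ih =>
        rw [Function.iterate_succ', Set.image_comp]
        exact ⟨ih.1.image (continuous_mulDiag α α), by rw [hm _ ih.1, ih.2, pow_succ', mul_assoc]⟩
    have h1 := measure_inter_eq_zero_of_card_mul_le (μ := repMeasure α) hF hF.measure_lt_top.ne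
      (S := digitSums (mulDiag α α) (E.image (diag α)) n) (a := diag α e) (b := diag α (e + y)) (by
        rw [← iterate_image_eq_biUnion hTF, hiter.2, digitSums_image_diag,
          Finset.card_image_of_injective _ (diag_injective α), h.card_digitSums]
        push_cast
        exact le_rfl)
      (by rw [digitSums_image_diag]; exact Finset.mem_image_of_mem _ he)
      (by rw [digitSums_image_diag]; exact Finset.mem_image_of_mem _ hey)
      (fun h2 => hy0' (by simpa using diag_injective α h2))
    have h2 := measure_inter_vadd_eq_zero_of_vadd h1
    rwa [← map_sub, add_sub_cancel_left] at h2

theorem IsLatticeTile.of_vadd {I : AddSubgroup K} {F : Set (RepSpace α)} {w : RepSpace α}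
    (h : IsLatticeTile (repMeasure α) (diagMap α I) (w +ᵥ F)) :
    IsLatticeTile (repMeasure α) (diagMap α I) F := by
  refine ⟨?_, add_vadd_eq_univ.1 h.cover, fun x hx hx0 => ?_⟩
  · simpa using h.isCompact.vadd (-w)
  · have h1 := h.overlap x hx hx0
    rwa [Set.inter_comm, vadd_vadd, measure_vadd_inter_vadd, add_sub_cancel_right,
      Set.inter_comm] at h1

theorem IsStandardDigitSet.isLatticeTile_of_isTiling (h𝒟 : IsStandardDigitSet α 𝒟)
    {D : Set (RepSpace α)} (hDc : IsCompact D)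
    (hD : IsTiling (repMeasure α) (translates α 𝒟 D)) :
    IsLatticeTile (repMeasure α) (diagMap α (digitModule α 𝒟).toAddSubgroup) D :=
  ((isTiling_translates_iff hDc).1 hD).isLatticeTile
    (isBoundedlyFinite_diagMap fun _ hx => h𝒟.digitModule_le hx) nsmul_diagMap_eq_zero hDc

/-- If `|𝒟|` is not an eigenvalue of the contact matrix, the self-affine tile gives a tiling. -/
theorem isTiling_of_contactMatrix (h𝒟 : IsStandardDigitSet α 𝒟) (hfin : 𝒟.Finite)
    (hα : ∀ φ : K →+* ℂ, 1 < ‖φ α‖) (hα0 : α ≠ 0) (hα1 : α ≠ 1) {D F : Set (RepSpace α)}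
    (hF : IsSelfAffineTile α 𝒟 F)
    (hD : IsLatticeTile (repMeasure α) (diagMap α (digitModule α 𝒟).toAddSubgroup) D)
    [Fintype (contactSet α 𝒟 D)]
    (hno : ∀ t : contactSet α 𝒟 D → ℝ,
      (contactMatrix α 𝒟 (contactSet α 𝒟 D)).mulVec t = (𝒟.ncard : ℝ) • t → t = 0) :
    IsTiling (repMeasure α) (translates α 𝒟 F) := by
  -- Any digit would do; subtracting it places all digits in `I`.
  obtain ⟨d₀, ⟨hd₀, -⟩, -⟩ := h𝒟.2 0 (zero_mem _)
  set I := (digitModule α 𝒟).toAddSubgroup with hIdef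
  have hI : ∀ x ∈ I, x ∈ Algebra.adjoin ℤ {α} := fun x hx => h𝒟.digitModule_le hx
  set E : Finset K := hfin.toFinset.image fun d => d - d₀ with hEdef
  have hE : (E : Set K) = (fun d => d - d₀) '' 𝒟 := by simp [hEdef]
  have hcard : E.card = 𝒟.ncard := by
    rw [hEdef, Finset.card_image_of_injective _ sub_left_injective, Set.ncard_eq_toFinset_card _ hfin]
  obtain ⟨hdig, hm⟩ := h𝒟.isDigitSystem hα hα0 hα1 hF hD hd₀ hE
  set T : K →+ K := AddMonoidHom.mulLeft α with hT
  have hVI : ∀ x ∈ contactSet α 𝒟 D, x ∈ I := fun x hx => (mem_digitModule_of_mem_contactSet hx).1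
  have hq : (0 : ℝ) < 𝒟.ncard := by
    rw [← hcard]; exact_mod_cast hdig.nonempty.card_pos
  have hC : ∀ x y, contactMatrix α 𝒟 (contactSet α 𝒟 D) x y = contactCount T E (x : K) y :=
    contactMatrix_eq_contactCount hE
  have hstep : ∀ (y : contactSet α 𝒟 D) (n : ℕ), exitCount T E (n + 1) (y : K) ≤
      ∑ x : contactSet α 𝒟 D, contactCount T E (x : K) y * exitCount T E n (x : K) := by
    refine fun y => hdig.exitCount_succ_le (hVI y y.2) fun x hx hx0 d hd d' hd' h => ?_
    obtain ⟨e, he, rfl⟩ : d ∈ (fun d => d - d₀) '' 𝒟 := hE ▸ Finset.mem_coe.2 hd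
    obtain ⟨e', he', rfl⟩ : d' ∈ (fun d => d - d₀) '' 𝒟 := hE ▸ Finset.mem_coe.2 hd'
    change α * x + (e - d₀) = y + (e' - d₀) at h
    exact mem_contactSet_of_mul_add_eq y.2 hx hx0 he he' (by linear_combination h)
  have hlim : ∀ y : contactSet α 𝒟 D, Tendsto (fun n => (exitCount T E n (y : K) : ℝ) / (E.card : ℝ) ^ n)
      atTop (𝓝 0) := by
    refine tendsto_zero_of_subinvariant (C := contactMatrix α 𝒟 (contactSet α 𝒟 D)) (q := 𝒟.ncard) (fun x y => ?_) hq
      (fun y => ?_) hno (b := fun n (y : contactSet α 𝒟 D) => (exitCount T E n (y : K) : ℝ) / (E.card : ℝ) ^ n)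
      (fun n y => by positivity) (fun y => ?_) (fun n y => ?_)
    · rw [hC]; positivity
    · simp only [hC]
      rw [← hcard]
      exact_mod_cast sum_contactCount_le (fun d hd d' hd' x hx x' hx' h =>
        (hdig.digit_unique' hd hd' (hVI x hx) (hVI x' hx') h).2) (y : K)
    · have h1 := exitCount_le_card (T := T) (E := E) 0 (y : K)
      rw [digitSums_zero, Finset.card_singleton] at h1
      simpa using h1
    · change _ ≤ (𝒟.ncard : ℝ)⁻¹ * ∑ x : contactSet α 𝒟 D, _ * contactMatrix α 𝒟 (contactSet α 𝒟 D) x y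
      have h1 : (exitCount T E (n + 1) (y : K) : ℝ) ≤
          ∑ x : contactSet α 𝒟 D, (contactCount T E (x : K) y : ℝ) * exitCount T E n (x : K) := by
        exact_mod_cast hstep y n
      rw [← hcard] at hq ⊢
      have h2 : ∑ x : contactSet α 𝒟 D, (exitCount T E n (x : K) : ℝ) / (E.card : ℝ) ^ n *
          contactMatrix α 𝒟 (contactSet α 𝒟 D) x y = (∑ x : contactSet α 𝒟 D, (contactCount T E (x : K) y : ℝ) *
            exitCount T E n (x : K)) / (E.card : ℝ) ^ n := by
        rw [Finset.sum_div]
        exact Finset.sum_congr rfl fun x _ => by rw [hC]; ring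
      rw [h2, pow_succ, inv_mul_eq_div, div_div]
      exact div_le_div_of_nonneg_right h1 (by positivity)
  -- Only the neighbours of `D`, that is `𝒱_0`, are needed here; the later `𝒱_k` make the recursion
  -- closed.
  have hle : I ≤ almostStabilizer T E I := by
    refine le_of_neighbors_mem hI (fun x hx => hx.1) (fun x hx => hdig.map_mem_almostStabilizer hx)
      hD.isCompact hD.cover fun x hx hne => ?_
    by_cases hx0 : x = 0
    · rw [hx0]; exact zero_mem _
    · have hxV : x ∈ contactSet α 𝒟 D := subset_contactSet 0 ⟨hx, hx0, by rwa [translate_eq_vadd]⟩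
      exact ⟨hx, hlim ⟨x, hxV⟩⟩
  have htile := hdig.isLatticeTile hI hα hm hD hF.1.vadd_set (hF.2.1.vadd _)
    (hF.image_vadd hE hα1) hle
  exact (isTiling_translates_iff hF.2.1).2
    (htile.of_vadd.almostPartition (isBoundedlyFinite_diagMap hI))

/-- Incongruence of the digits modulo `αℤ[α]` suffices, so this needs neither a tile nor the shift
by a digit (`d₀ = 0`). -/
theorem sum_contactMatrix_le (h𝒟 : IsStandardDigitSet α 𝒟) (hfin : 𝒟.Finite) (hα0 : α ≠ 0)
    {D : Set (RepSpace α)} [Fintype (contactSet α 𝒟 D)] (y : contactSet α 𝒟 D) :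
    ∑ x, contactMatrix α 𝒟 (contactSet α 𝒟 D) x y ≤ 𝒟.ncard := by
  simp only [contactMatrix_eq_contactCount (d₀ := 0) (E := hfin.toFinset) (𝒟 := 𝒟) (by simp)]
  rw [Set.ncard_eq_toFinset_card _ hfin]
  refine mod_cast sum_contactCount_le (fun d hd d' hd' x hx x' hx' h => ?_) (y : K)
  change d + α * x = d' + α * x' at h
  have h1 : d = d' := h𝒟.eq_of_sub_eq_mul (hfin.mem_toFinset.1 hd) (hfin.mem_toFinset.1 hd')
    (h𝒟.digitModule_le (sub_mem (mem_digitModule_of_mem_contactSet hx').1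
      (mem_digitModule_of_mem_contactSet hx).1)) (by linear_combination h)
  subst h1
  exact mul_left_cancel₀ hα0 (add_left_cancel h)

/-- An eigenvector of the contact matrix can be made nonzero and even. -/
theorem exists_even_eigenvector {D : Set (RepSpace α)} [Fintype (contactSet α 𝒟 D)] {q : ℝ}
    (hq : 0 < q) (hsum : ∀ y, ∑ x, contactMatrix α 𝒟 (contactSet α 𝒟 D) x y ≤ q)
    (σ : Equiv.Perm (contactSet α 𝒟 D)) (hσ : ∀ x, (σ x : K) = -x) {t : contactSet α 𝒟 D → ℝ}
    (ht : (contactMatrix α 𝒟 (contactSet α 𝒟 D)).mulVec t = q • t) (ht0 : t ≠ 0) :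
    ∃ s : contactSet α 𝒟 D → ℝ, s ≠ 0 ∧ (∀ x, s (σ x) = s x) ∧
      (contactMatrix α 𝒟 (contactSet α 𝒟 D)).mulVec s = q • s := by
  have habs : (contactMatrix α 𝒟 (contactSet α 𝒟 D)).mulVec |t| = q • |t| := mulVec_abs_eq_smul (fun x y => Nat.cast_nonneg _) hq hsum ht
  have hσσ : ∀ x, σ (σ x) = x := fun x => Subtype.ext (by rw [hσ, hσ, neg_neg])
  refine ⟨fun x => |t| x + |t| (σ x), fun h0 => ht0 (funext fun x => ?_), fun x => ?_, ?_⟩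
  · have h1 : |t x| + |t (σ x)| = 0 := congrFun h0 x
    exact abs_eq_zero.1 (by linarith [abs_nonneg (t x), abs_nonneg (t (σ x))])
  · simp only [hσσ, add_comm]
  · have h2 : (contactMatrix α 𝒟 (contactSet α 𝒟 D)).mulVec (fun x => |t| (σ x)) =
        q • fun x => |t| (σ x) := by
      funext x
      have h3 := congrFun habs (σ x)
      simp only [Matrix.mulVec, dotProduct] at h3 ⊢
      rw [← Equiv.sum_comp σ] at h3
      simp only [contactMatrix_neg (hσ x) (hσ _)] at h3
      exact h3
    have h3 : (fun x => |t| x + |t| (σ x)) = |t| + fun x => |t| (σ x) := rfl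
    rw [h3, Matrix.mulVec_add, habs, h2, smul_add]

end TilingCriterion

end SelfAffine

/-! ### The proposition. -/

open SelfAffine
theorem mainTheorem9 {K : Type*} [Field K] [NumberField K] (α : K)
    (hα : IntermediateField.adjoin ℚ {α} = ⊤)
    (A : Polynomial ℤ) (hA : IsPrimitiveMinpoly A α) (hexp : IsExpanding A)
    (𝒟 : Set K) (h𝒟 : IsStandardDigitSet α 𝒟)
    (F : Set (RepSpace α)) (hF : IsSelfAffineTile α 𝒟 F)
    (D : Set (RepSpace α)) (hDc : IsCompact D)
    (hD : IsTiling (repMeasure α) (translates α 𝒟 D)) :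
    ∃ hV : (contactSet α 𝒟 D).Finite,
      letI : Fintype (contactSet α 𝒟 D) := hV.fintype
      ¬ IsTiling (repMeasure α) (translates α 𝒟 F) →
        ∃ f : OmegaHat α (contactSet α 𝒟 D),
          (¬ ∃ c : ℂ, ∀ z, (f : RepSpace α → ℂ) z = c) ∧
          (∀ z, ((f : RepSpace α → ℂ) z).im = 0) ∧
          contactHat α 𝒟 (contactSet α 𝒟 D) f = ((|A.coeff 0| : ℤ) : ℝ) • f := by
  have hφ := hexp.one_lt_norm_embedding hA.2.2
  have hα0 := hexp.ne_zero hA.2.2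
  have hα1 := hexp.ne_one hA.2.2
  obtain ⟨hfin, hncard⟩ := h𝒟.finite_and_ncard hA hexp
  refine ⟨finite_contactSet hDc hφ h𝒟 hfin, fun hnot => ?_⟩
  let : Fintype (contactSet α 𝒟 D) := (finite_contactSet hDc hφ h𝒟 hfin).fintype
  have hDt := h𝒟.isLatticeTile_of_isTiling hDc hD
  have hq : ((|A.coeff 0| : ℤ) : ℝ) = (𝒟.ncard : ℝ) := by rw [← hncard, Int.cast_natCast]
  rw [hq]
  obtain ⟨t, ht, ht0⟩ : ∃ t : contactSet α 𝒟 D → ℝ,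
      (contactMatrix α 𝒟 (contactSet α 𝒟 D)).mulVec t = (𝒟.ncard : ℝ) • t ∧ t ≠ 0 := by
    by_contra! hno
    exact hnot (isTiling_of_contactMatrix h𝒟 hfin hφ hα0 hα1 hF hDt hno)
  have hsum : ∀ y, ∑ x, contactMatrix α 𝒟 (contactSet α 𝒟 D) x y ≤ (𝒟.ncard : ℝ) :=
    sum_contactMatrix_le h𝒟 hfin hα0
  -- The symmetry `x ↦ -x` of the contact set, used to make the eigenvector even and hence the
  -- function real.
  let σ : Equiv.Perm (contactSet α 𝒟 D) := Function.Involutive.toPerm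
    (fun x => ⟨-x, neg_mem_contactSet x.2⟩) fun x => Subtype.ext (neg_neg _)
  have hσ : ∀ x, (σ x : K) = -x := fun x => rfl
  have hq0 : (0 : ℝ) < 𝒟.ncard := by
    rw [← hq]
    exact_mod_cast abs_pos.2 hexp.coeff_zero_ne_zero
  obtain ⟨s, hs0, hsσ, hs⟩ := exists_even_eigenvector hq0 hsum σ hσ ht ht0
  refine ⟨(fourierCoeffs α (contactSet α 𝒟 D)).symm s, ?_, ?_, ?_⟩
  · exact not_const_fourierInv α _ (fun h0 => (mem_digitModule_of_mem_contactSet h0).2 rfl) hs0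
  · exact im_fourierInv_eq_zero α _ σ hσ hsσ
  · simp only [contactHat, LinearMap.comp_apply, LinearEquiv.coe_coe, LinearEquiv.apply_symm_apply,
      Matrix.mulVecLin_apply, hs, map_smul]
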